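/- **Batch Gaussian KDE.** Given $x^{(1)},\dots,x^{(n)},y^{(1)},\dots,y^{(n)}\in\mathbb R^m$, a vector $w\in\mathbb R^n$ and an error parameter $\delta>0$, let $K\in\mathbb R^{n\times n}$, $K[i,j]=e^{-\|x^{(i)}-y^{(j)}\|_2^2}$; the task is to output $v\in\mathbb R^n$ with $\|Kw-v\|_\infty\le\delta\|w\|_1$. Running time is measured on a deterministic real RAM: exact field operations $+,-,\times,\div$ and comparisons of real numbers cost one unit each, natural numbers are used for counting and addressing memory, and operations on them cost (up to an additive one) the bit lengths of the numbers involved. For $\alpha,\beta,\kappa>0$ consider the inputs with $n\ge1$ in dimension $m=\alpha\log n$ (rounded to an integer; any $m\le\lceil\alpha\log n\rceil$ is allowed), with $\delta=n^{-\beta}$ and with $\|x^{(i)}-y^{(j)}\|_2^2\le B=\kappa\log n$ for all $i,j$. Say that batch Gaussian KDE can be solved in time $O(f(n))$ for $(\alpha,\beta,\kappa)$ if one program, which may depend on $\alpha,\beta,\kappa$, solves it on all these inputs, for all $n \geq 1$, with worst-case running time $O(f(n))$ as $n\to\infty$ (the implied constant may depend on $\alpha,\beta,\kappa$). All logarithms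 are natural. **Corollary.** Let $\alpha,\beta>0$. 1. There is a constant $c=c(\alpha,\beta)>0$ such that for every $0<\kappa<\frac12$ batch Gaussian KDE can be solved in time $$O\!\left(n^{\,1+c\,\max\{1,\ \log\log\kappa^{-1}\}/\log\kappa^{-1}}\right)$$ for $(\alpha,\beta,\kappa)$. In particular, for every $0<\kappa\le e^{-e}$ it can be solved in time $O\big(n^{1+c\log\log\kappa^{-1}/\log\kappa^{-1}}\big)$. 2. For every $0<\kappa_0<e^{-1}$ there is a constant $c=c(\alpha,\beta,\kappa_0)>0$ such that for every $0<\kappa\le\kappa_0$ batch Gaussian KDE can be solved in time $O\big(n^{1+c\log\log\kappa^{-1}/\log\kappa^{-1}}\big)$ for $(\alpha,\beta,\kappa)$. -/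

import Mathlib

/-! ### The real RAM

A deterministic random access machine over the reals, programmed in a structured language.
Real numbers are manipulated exactly, by field operations and comparisons at unit cost (there is
no rounding, no exponential and no conversion from reals to integers).  Natural numbers serve for
counting and for addressing the memory; operations on them are charged the bit lengths of the
numbers involved (logarithmic cost). -/

namespace RealRAM

/-- A memory configuration: scalar registers and arrays, for natural and for real numbers.
Register numbers and array numbers are fixed in the program text; positions inside an array are
computed at run time. -/
structure State where
  natReg : ℕ → ℕ
  natArr : ℕ → ℕ → ℕ
  realReg : ℕ → ℝ
  realArr : ℕ → ℕ → ℝ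

/-- Elementary instructions. The first argument names the destination. -/
inductive Instr where
  /-- `n_i := k` -/
  | setNat (i k : ℕ)
  /-- `n_i := n_j + n_k` -/
  | addNat (i j k : ℕ)
  /-- `n_i := max (n_j - n_k) 0` -/
  | subNat (i j k : ℕ)
  /-- `n_i := n_j * n_k` -/
  | mulNat (i j k : ℕ)
  /-- `n_i := N_a[n_j]` -/
  | readNat (i a j : ℕ)
  /-- `N_a[n_i] := n_j` -/
  | writeNat (a i j : ℕ)
  /-- `r_i := q`, a rational constant of the program -/
  | setReal (i : ℕ) (q : ℚ)
  /-- `r_i := r_j + r_k` -/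
  | addReal (i j k : ℕ)
  /-- `r_i := r_j - r_k` -/
  | subReal (i j k : ℕ)
  /-- `r_i := r_j * r_k` -/
  | mulReal (i j k : ℕ)
  /-- `r_i := r_j / r_k` (with value `0` if `r_k = 0`) -/
  | divReal (i j k : ℕ)
  /-- `r_i := R_a[n_j]` -/
  | readReal (i a j : ℕ)
  /-- `R_a[n_i] := r_j` -/
  | writeReal (a i j : ℕ)

/-- The effect of an instruction. -/
noncomputable def Instr.exec (s : State) : Instr → State
  | .setNat i k => { s with natReg := Function.update s.natReg i k }
  | .addNat i j k =>
      { s with natReg := Function.update s.natReg i (s.natReg j + s.natReg k) }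
  | .subNat i j k =>
      { s with natReg := Function.update s.natReg i (s.natReg j - s.natReg k) }
  | .mulNat i j k =>
      { s with natReg := Function.update s.natReg i (s.natReg j * s.natReg k) }
  | .readNat i a j =>
      { s with natReg := Function.update s.natReg i (s.natArr a (s.natReg j)) }
  | .writeNat a i j =>
      { s with natArr :=
                Function.update s.natArr a (Function.update (s.natArr a) (s.natReg i) (s.natReg j)) }
  | .setReal i q => { s with realReg := Function.update s.realReg i (q : ℝ) }
  | .addReal i j k =>
      { s with realReg := Function.update s.realReg i (s.realReg j + s.realReg k) }
  | .subReal i j k =>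
      { s with realReg := Function.update s.realReg i (s.realReg j - s.realReg k) }
  | .mulReal i j k =>
      { s with realReg := Function.update s.realReg i (s.realReg j * s.realReg k) }
  | .divReal i j k =>
      { s with realReg := Function.update s.realReg i (s.realReg j / s.realReg k) }
  | .readReal i a j =>
      { s with realReg := Function.update s.realReg i (s.realArr a (s.natReg j)) }
  | .writeReal a i j =>
      { s with realArr :=
                Function.update s.realArr a (Function.update (s.realArr a) (s.natReg i) (s.realReg j)) }

/-- The cost of an instruction: one, plus the bit lengths of the natural numbers it uses
(operands, addresses, and transferred values). -/
def Instr.cost (s : State) : Instr → ℕ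
  | .setNat _ _ => 1
  | .addNat _ j k | .subNat _ j k | .mulNat _ j k =>
      1 + Nat.size (s.natReg j) + Nat.size (s.natReg k)
  | .readNat _ a j =>
      1 + Nat.size (s.natReg j) + Nat.size (s.natArr a (s.natReg j))
  | .writeNat _ i j => 1 + Nat.size (s.natReg i) + Nat.size (s.natReg j)
  | .setReal _ _ => 1
  | .addReal _ _ _ | .subReal _ _ _ | .mulReal _ _ _ | .divReal _ _ _ => 1
  | .readReal _ _ j => 1 + Nat.size (s.natReg j)
  | .writeReal _ i _ => 1 + Nat.size (s.natReg i)

/-- Tests used in branches and loops: `n_i < n_j` and `r_i < r_j`. -/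
inductive Test where
  | natLt (i j : ℕ)
  | realLt (i j : ℕ)

/-- The truth of a test. -/
def Test.Holds (s : State) : Test → Prop
  | .natLt i j => s.natReg i < s.natReg j
  | .realLt i j => s.realReg i < s.realReg j

/-- The cost of a test. -/
def Test.cost (s : State) : Test → ℕ
  | .natLt i j => 1 + Nat.size (s.natReg i) + Nat.size (s.natReg j)
  | .realLt _ _ => 1

/-- Programs. -/
inductive Program where
  | skip
  | basic (c : Instr)
  | seq (p q : Program)
  | ite (b : Test) (p q : Program)
  | while (b : Test) (p : Program)

/-- `Runs p s t s'`: started in state `s`, the program `p` halts in state `s'` after exactly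
`t` units of time. -/
inductive Runs : Program → State → ℕ → State → Prop where
  | skip (s : State) : Runs .skip s 1 s
  | basic (c : Instr) (s : State) : Runs (.basic c) s (c.cost s) (c.exec s)
  | seq {p q : Program} {s s₁ s₂ : State} {t₁ t₂ : ℕ}
      (hp : Runs p s t₁ s₁) (hq : Runs q s₁ t₂ s₂) : Runs (.seq p q) s (t₁ + t₂) s₂
  | iteTrue {b : Test} {p q : Program} {s s₁ : State} {t : ℕ}
      (hb : b.Holds s) (hp : Runs p s t s₁) : Runs (.ite b p q) s (b.cost s + t) s₁
  | iteFalse {b : Test} {p q : Program} {s s₁ : State} {t : ℕ}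
      (hb : ¬ b.Holds s) (hq : Runs q s t s₁) : Runs (.ite b p q) s (b.cost s + t) s₁
  | whileTrue {b : Test} {p : Program} {s s₁ s₂ : State} {t₁ t₂ : ℕ}
      (hb : b.Holds s) (hp : Runs p s t₁ s₁) (hw : Runs (.while b p) s₁ t₂ s₂) :
      Runs (.while b p) s (b.cost s + t₁ + t₂) s₂
  | whileFalse {b : Test} {p : Program} {s : State}
      (hb : ¬ b.Holds s) : Runs (.while b p) s (b.cost s) s

end RealRAM

/-! ### Batch Gaussian kernel density estimation -/

namespace BatchKDE

/-- The Gaussian kernel matrix `K[i,j] = exp (-‖xᵢ - yⱼ‖₂²)`. -/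
noncomputable def kernelMatrix {n m : ℕ} (x y : Fin n → EuclideanSpace ℝ (Fin m)) :
    Matrix (Fin n) (Fin n) ℝ :=
  Matrix.of fun i j => Real.exp (-‖x i - y j‖ ^ 2)

/-- `v` is an admissible output: `‖K w - v‖_∞ ≤ δ ‖w‖₁`.
(The norm of `Fin n → ℝ` is the supremum norm.) -/
def IsSolution {n m : ℕ} (x y : Fin n → EuclideanSpace ℝ (Fin m)) (w : Fin n → ℝ) (δ : ℝ)
    (v : Fin n → ℝ) : Prop :=
  ‖(kernelMatrix x y).mulVec w - v‖ ≤ δ * ∑ j, |w j|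

/-- A matrix stored row by row in an array, with zeros behind it. -/
noncomputable def flatten {n m : ℕ} (x : Fin n → EuclideanSpace ℝ (Fin m)) (p : ℕ) : ℝ :=
  if h : p / m < n ∧ p % m < m then x ⟨p / m, h.1⟩ ⟨p % m, h.2⟩ else 0

/-- The memory at the start: `n` and `m` in the first two natural registers, `δ` in the first real
register, the points `x` and `y` and the weights `w` in the real arrays `0`, `1`, `2`, and zeros
everywhere else. -/
noncomputable def input {n m : ℕ} (x y : Fin n → EuclideanSpace ℝ (Fin m)) (w : Fin n → ℝ)
    (δ : ℝ) : RealRAM.State where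
  natReg i := if i = 0 then n else if i = 1 then m else 0
  natArr _ _ := 0
  realReg i := if i = 0 then δ else 0
  realArr a p :=
    if a = 0 then flatten x p
    else if a = 1 then flatten y p
    else if a = 2 then (if h : p < n then w ⟨p, h⟩ else 0)
    else 0

/-- The output is read off from the first `n` cells of the real array `3`. -/
def output (n : ℕ) (s : RealRAM.State) : Fin n → ℝ := fun i => s.realArr 3 i

/-- Batch Gaussian KDE with `n` sources and `n` targets in dimension `α log n`, error parameter
`δ = n ^ (-β)` and squared distances between sources and targets at most `B = κ log n` can be
solved in time `O(f n)`: a single real RAM program is correct on all such inputs, for all `n`, and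
its worst case running time is `O(f n)` as `n → ∞`.  The dimension may be any natural number up to
`α log n` rounded up. -/
def SolvableInTime (α β κ : ℝ) (f : ℕ → ℝ) : Prop :=
  ∃ (prog : RealRAM.Program) (T : ℕ → ℕ),
    (fun n => (T n : ℝ)) =O[Filter.atTop] f ∧
    ∀ n m : ℕ, 1 ≤ n → m ≤ ⌈α * Real.log n⌉₊ →
      ∀ (x y : Fin n → EuclideanSpace ℝ (Fin m)) (w : Fin n → ℝ),
        (∀ i j, ‖x i - y j‖ ^ 2 ≤ κ * Real.log n) →
        ∃ (t : ℕ) (s : RealRAM.State),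
          RealRAM.Runs prog (input x y w ((n : ℝ) ^ (-β))) t s ∧ t ≤ T n ∧
          IsSolution x y w ((n : ℝ) ^ (-β)) (output n s)

end BatchKDE

/-! ### Total correctness with a time bound -/

namespace RealRAM

/-! This is the polynomial method. Put L = log κ⁻¹. On [0, κ log n] the function exp(-t) is replaced
by its Taylor polynomial of degree about γ log n or more. By `abs_exp_neg_sub_sum_le_rpow` the error
is at most n^(-γ(log(γ/κ) - 1)). With γ = a/b, b = ⌈L⌉ and a depending only on β, this is at most
n^(-β) (`degree_params`). So a degree of order log n / L suffices.

The number -‖x - y‖² is an inner product of two lifted points in dimension M = m + 2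
(`sum_liftPoint_mul_liftPoint`). The multinomial theorem therefore writes the polynomial kernel as a
sum, over the monomials of degree at most q in M variables, of a function of x times a function of y
(`sum_multiIndices`). The weighted sum over the sources is thus computed once per monomial
(moments), and each target then needs a single sum over the monomials (potentials). This takes about
n · C(M + q, q) steps instead of n².

By `choose_add_le_exp`, the logarithm of C(M + q, q) is at most q log(2(1 + L)) + M/(1 + L). For q
of order log n / L and M of order log n this is O(max(1, log L)/L) · log n, the required exponent.

On the machine the degree is found by repeated integer multiplication. The monomials are generated
as a tree, so that each value costs one multiplication (`IsMonomialTree`, `Lists`). Counts are kept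
in units of 1 + 2 · size B, where B bounds every natural number in memory. The logarithmic overheads
are absorbed by an extra η > 0 in the exponent, chosen of the same order as the main term.

In the second part log log κ⁻¹ is bounded below by a positive constant, so the maximum with 1 costs
only a constant factor in c. -/

/-- All natural numbers in the memory are at most `B`. -/
def State.BoundedBy (s : State) (B : ℕ) : Prop :=
  (∀ i, s.natReg i ≤ B) ∧ ∀ a p, s.natArr a p ≤ B

/-- The natural number computed by the instruction, if there is one, is at most `B`. -/
def Instr.Fits (B : ℕ) (s : State) : Instr → Prop
  | .setNat _ k => k ≤ B
  | .addNat _ j k => s.natReg j + s.natReg k ≤ B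
  | .mulNat _ j k => s.natReg j * s.natReg k ≤ B
  | _ => True

theorem Instr.cost_le {s : State} {B : ℕ} (h : s.BoundedBy B) (c : Instr) :
    c.cost s ≤ 1 + 2 * Nat.size B := by
  have h1 := fun i => Nat.size_le_size (h.1 i)
  have h2 := fun a p => Nat.size_le_size (h.2 a p)
  cases c with
  | setNat i k => simp [Instr.cost]
  | setReal i k => simp [Instr.cost]
  | addNat i j k => have := h1 j; have := h1 k; simp only [Instr.cost]; omega
  | subNat i j k => have := h1 j; have := h1 k; simp only [Instr.cost]; omega
  | mulNat i j k => have := h1 j; have := h1 k; simp only [Instr.cost]; omega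
  | readNat i a j =>
    have := h1 j; have := h2 a (s.natReg j); simp only [Instr.cost]; omega
  | writeNat a i j => have := h1 i; have := h1 j; simp only [Instr.cost]; omega
  | addReal i j k => simp [Instr.cost]
  | subReal i j k => simp [Instr.cost]
  | mulReal i j k => simp [Instr.cost]
  | divReal i j k => simp [Instr.cost]
  | readReal i a j => have := h1 j; simp only [Instr.cost]; omega
  | writeReal a i j => have := h1 i; simp only [Instr.cost]; omega

theorem Test.cost_le {s : State} {B : ℕ} (h : s.BoundedBy B) (b : Test) :
    b.cost s ≤ 1 + 2 * Nat.size B := by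
  cases b with
  | natLt i j =>
    have := Nat.size_le_size (h.1 i)
    have := Nat.size_le_size (h.1 j)
    simp only [Test.cost]; omega
  | realLt i j => simp [Test.cost]

theorem State.BoundedBy.setReg {s : State} {B v : ℕ} (h : s.BoundedBy B) (hv : v ≤ B) (i : ℕ) :
    State.BoundedBy { s with natReg := Function.update s.natReg i v } B := by
  refine ⟨fun k => ?_, h.2⟩
  by_cases hk : k = i
  · simpa [hk] using hv
  · simpa [hk] using h.1 k

/-- Only constants, sums and products can create a larger number. Truncated subtraction and memory
transfers cannot, so `Instr.Fits` asks nothing of them. -/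
theorem State.BoundedBy.exec {s : State} {B : ℕ} (h : s.BoundedBy B) {c : Instr}
    (hc : c.Fits B s) : (c.exec s).BoundedBy B := by
  cases c with
  | setNat i k => exact h.setReg hc i
  | addNat i j k => exact h.setReg hc i
  | mulNat i j k => exact h.setReg hc i
  | subNat i j k => exact h.setReg ((Nat.sub_le _ _).trans (h.1 j)) i
  | readNat i a j => exact h.setReg (h.2 _ _) i
  | writeNat a i j =>
    refine ⟨h.1, fun b p => ?_⟩
    simp only [Instr.exec, Function.update_apply]
    split_ifs
    · simp only [Function.update_apply]
      split_ifs
      · exact h.1 j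
      · exact h.2 _ _
    · exact h.2 _ _
  | setReal i k => exact h
  | addReal i j k => exact h
  | subReal i j k => exact h
  | mulReal i j k => exact h
  | divReal i j k => exact h
  | readReal i a j => exact h
  | writeReal a i j => exact h

/-- Straight-line code. -/
def Program.block : List Instr → Program
  | [] => .skip
  | c :: cs => .seq (.basic c) (block cs)

/-- The effect of straight-line code. -/
noncomputable def execBlock (s : State) : List Instr → State
  | [] => s
  | c :: cs => execBlock (c.exec s) cs

/-- All natural numbers computed by the straight-line code are at most `B`. -/
def FitsBlock (B : ℕ) (s : State) : List Instr → Prop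
  | [] => True
  | c :: cs => c.Fits B s ∧ FitsBlock B (c.exec s) cs

/-- Started in `s`, the program halts within `k` units of `1 + 2 * Nat.size B`, in a state that
satisfies `Q` and whose natural numbers are at most `B`. -/
def Program.Ensures (B : ℕ) (p : Program) (k : ℕ) (s : State) (Q : State → Prop) : Prop :=
  ∃ t s', Runs p s t s' ∧ t ≤ k * (1 + 2 * Nat.size B) ∧ s'.BoundedBy B ∧ Q s'

namespace Program.Ensures

variable {B k k' : ℕ} {p q : Program} {s : State} {Q R : State → Prop}

theorem mono (h : p.Ensures B k s R) (hk : k ≤ k') (hQ : ∀ s', s'.BoundedBy B → R s' → Q s') :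
    p.Ensures B k' s Q := by
  obtain ⟨t, s', hr, ht, hb, hs⟩ := h
  exact ⟨t, s', hr, ht.trans (Nat.mul_le_mul_right _ hk), hb, hQ s' hb hs⟩

theorem seq (hp : p.Ensures B k s R) (hq : ∀ s', s'.BoundedBy B → R s' → q.Ensures B k' s' Q) :
    (p.seq q).Ensures B (k + k') s Q := by
  obtain ⟨t, s', hr, ht, hb, hs⟩ := hp
  obtain ⟨t', s'', hr', ht', hb', hs'⟩ := hq s' hb hs
  exact ⟨t + t', s'', .seq hr hr', by rw [add_mul]; omega, hb', hs'⟩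

/-- One unit pays for each instruction, and the additional one for the closing `skip`. -/
theorem block {cs : List Instr} (hs : s.BoundedBy B) (hf : FitsBlock B s cs)
    (hQ : Q (execBlock s cs)) : (Program.block cs).Ensures B (cs.length + 1) s Q := by
  induction cs generalizing s with
  | nil => exact ⟨1, s, .skip s, by simp, hs, hQ⟩
  | cons c cs ih =>
    obtain ⟨t, s', hr, ht, hb, hs'⟩ := ih (hs.exec hf.1) hf.2 hQ
    refine ⟨_, s', .seq (.basic c s) hr, ?_, hb, hs'⟩
    have := c.cost_le hs
    rw [List.length_cons, add_right_comm, add_mul, one_mul]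
    omega

theorem ite {b : Test} (hs : s.BoundedBy B) (hp : b.Holds s → p.Ensures B k s Q)
    (hq : ¬ b.Holds s → q.Ensures B k' s Q) :
    (Program.ite b p q).Ensures B (max k k' + 1) s Q := by
  have hb := b.cost_le hs
  have hk := Nat.mul_le_mul_right (1 + 2 * Nat.size B) (le_max_left k k')
  have hk' := Nat.mul_le_mul_right (1 + 2 * Nat.size B) (le_max_right k k')
  by_cases h : b.Holds s
  · obtain ⟨t, s', hr, ht, hb', hs'⟩ := hp h
    exact ⟨_, s', .iteTrue h hr, by rw [add_mul, one_mul]; omega, hb', hs'⟩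
  · obtain ⟨t, s', hr, ht, hb', hs'⟩ := hq h
    exact ⟨_, s', .iteFalse h hr, by rw [add_mul, one_mul]; omega, hb', hs'⟩

/-- A loop with invariant `I`, which is indexed by the number of iterations done. -/
theorem loop {b : Test} (I : ℕ → State → Prop) (D : ℕ) (hs : s.BoundedBy B) (h0 : I 0 s)
    (hI : ∀ i s, s.BoundedBy B → I i s → b.Holds s → i < D ∧ p.Ensures B k s (I (i + 1))) :
    (Program.while b p).Ensures B (D * (k + 1) + 1) s
      (fun s' => ∃ i, I i s' ∧ ¬ b.Holds s') := by
  -- Induction on the number d of iterations still allowed. At d = 0 a successful test would give i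
  -- < D = i.
  suffices H : ∀ d i s, d + i = D → s.BoundedBy B → I i s →
      (Program.while b p).Ensures B (d * (k + 1) + 1) s (fun s' => ∃ i, I i s' ∧ ¬ b.Holds s') from
    H D 0 s rfl hs h0
  intro d
  induction d with
  | zero =>
    intro i s hd hs hi
    have hc := b.cost_le hs
    by_cases h : b.Holds s
    · have := (hI i s hs hi h).1
      omega
    · exact ⟨_, s, .whileFalse h, by omega, hs, i, hi, h⟩
  | succ d ih =>
    intro i s hd hs hi
    have hc := b.cost_le hs
    by_cases h : b.Holds s
    · obtain ⟨t, s', hr, ht, hb', hs'⟩ := (hI i s hs hi h).2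
      obtain ⟨t', s'', hr', ht', hb'', hs''⟩ := ih (i + 1) s' (by omega) hb' hs'
      refine ⟨_, s'', .whileTrue h hr hr', ?_, hb'', hs''⟩
      have : ((d + 1) * (k + 1) + 1) * (1 + 2 * Nat.size B) =
          (1 + 2 * Nat.size B) + k * (1 + 2 * Nat.size B) +
            (d * (k + 1) + 1) * (1 + 2 * Nat.size B) := by ring
      omega
    · refine ⟨_, s, .whileFalse h, ?_, hs, i, hi, h⟩
      nlinarith [Nat.zero_le ((d + 1) * (k + 1) * (1 + 2 * Nat.size B))]

end Program.Ensures

end RealRAM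

/-! ### Evaluation of monomials at a point -/

namespace RealRAM

/-- Lift a point `p` of dimension `m` to a point of dimension `m + 2`; the two new coordinates are
affine functions of `‖p‖²`. -/
noncomputable def liftPoint (m : ℕ) (c A₁ B₁ A₂ B₂ : ℝ) (p : ℕ → ℝ) (l : ℕ) : ℝ :=
  if l < m then c * p l
  else if l = m then A₁ + B₁ * ∑ i ∈ Finset.range m, p i ^ 2
  else A₂ + B₂ * ∑ i ∈ Finset.range m, p i ^ 2

/-- The value of a monomial in `M` variables. -/
def monomialAt (M : ℕ) (z : ℕ → ℝ) (μ : ℕ → ℕ) : ℝ :=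
  ∏ l ∈ Finset.range M, z l ^ μ l

theorem monomialAt_zero (M : ℕ) (z : ℕ → ℝ) : monomialAt M z 0 = 1 := by simp [monomialAt]

theorem monomialAt_add_single {M l : ℕ} (hl : l < M) (z : ℕ → ℝ) (μ : ℕ → ℕ) :
    monomialAt M z (μ + Pi.single l 1) = monomialAt M z μ * z l := by
  have : ∀ i ∈ Finset.range M, z i ^ (μ + Pi.single l 1 : ℕ → ℕ) i =
      z i ^ μ i * (if i = l then z l else 1) := by
    intro i _
    by_cases h : i = l
    · subst h; simp [pow_succ]
    · simp [h]
  rw [monomialAt, Finset.prod_congr rfl this, Finset.prod_mul_distrib, Finset.prod_ite_eq']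
  simp [hl, monomialAt]

/-- The tables `par` and `lett` describe the multi-indices `mu e`, `e < N`: each of them, except for
`mu 0 = 0`, arises from that of a smaller number `par e` by raising the exponent of the letter
`lett e` by one. -/
structure IsMonomialTree (M N : ℕ) (par lett : ℕ → ℕ) (mu : ℕ → ℕ → ℕ) : Prop where
  pos : 0 < N
  root : mu 0 = 0
  par_lt : ∀ e < N, e ≠ 0 → par e < e
  lett_lt : ∀ e < N, e ≠ 0 → lett e < M
  mu_eq : ∀ e < N, e ≠ 0 → mu e = mu (par e) + Pi.single (lett e) 1

/-- Store the lift of the point which starts in the real array `a` at position `n₇` in the real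
array `5`, and move `n₇` behind the point. -/
def loadPoint (a : ℕ) (c A₁ B₁ A₂ B₂ : ℚ) : Program :=
  (Program.block [.setNat 8 0, .setReal 1 0, .setReal 2 c]).seq <|
  (Program.while (.natLt 8 1) (Program.block [.readReal 3 a 7, .mulReal 4 3 3, .addReal 1 1 4,
    .mulReal 3 3 2, .writeReal 5 8 3, .addNat 7 7 2, .addNat 8 8 2])).seq <|
  Program.block [.setReal 2 A₁, .setReal 3 B₁, .mulReal 3 3 1, .addReal 2 2 3, .writeReal 5 8 2,
    .addNat 8 8 2, .setReal 2 A₂, .setReal 3 B₂, .mulReal 3 3 1, .addReal 2 2 3, .writeReal 5 8 2]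

/-- Only the real arrays `5` and `6`, the natural registers from `7` on and the real registers may
have changed. -/
structure SameTables (s s' : State) : Prop where
  natArr : s'.natArr = s.natArr
  realArr : ∀ a, a ≠ 5 → a ≠ 6 → s'.realArr a = s.realArr a
  natReg : ∀ i < 7, s'.natReg i = s.natReg i

theorem SameTables.trans {s s' s'' : State} (h : SameTables s s') (h' : SameTables s' s'') :
    SameTables s s'' where
  natArr := h'.natArr.trans h.natArr
  realArr a h5 h6 := (h'.realArr a h5 h6).trans (h.realArr a h5 h6)
  natReg i hi := (h'.natReg i hi).trans (h.natReg i hi)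

/-- While the scaled coordinates are copied, the squared norm accumulates in real register 1; the
last block turns it into the two additional coordinates. The source array must differ from the two
scratch arrays 5 and 6. -/
theorem loadPoint_ensures {s : State} {B a m o : ℕ} (c A₁ B₁ A₂ B₂ : ℚ) {p : ℕ → ℝ}
    (hs : s.BoundedBy B) (ha5 : a ≠ 5) (ha6 : a ≠ 6) (hone : s.natReg 2 = 1) (hm : s.natReg 1 = m)
    (ho : s.natReg 7 = o) (hp : ∀ l < m, s.realArr a (o + l) = p l) (hB : o + m + 2 ≤ B) :
    (loadPoint a c A₁ B₁ A₂ B₂).Ensures B (9 * m + 17) s (fun s' =>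
      SameTables s s' ∧ s'.natReg 7 = o + m ∧
      ∀ l < m + 2, s'.realArr 5 l = liftPoint m c A₁ B₁ A₂ B₂ p l) := by
  let I : ℕ → State → Prop := fun k s' =>
    SameTables s s' ∧ s'.natReg 7 = o + k ∧ s'.natReg 8 = k ∧ k ≤ m ∧
    s'.realReg 1 = ∑ i ∈ Finset.range k, p i ^ 2 ∧ s'.realReg 2 = c ∧
    ∀ l < k, s'.realArr 5 l = c * p l
  -- The count follows the shape of the program: a block of r instructions gives r + 1, a loop of at
  -- most D rounds with a body of k units gives D(k + 1) + 1.
  refine Program.Ensures.mono (k := (3 + 1) + ((m * ((7 + 1) + 1) + 1) + (11 + 1)))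
    (R := fun s' => SameTables s s' ∧ s'.natReg 7 = o + m ∧
      ∀ l < m + 2, s'.realArr 5 l = liftPoint m c A₁ B₁ A₂ B₂ p l) ?_ (by omega)
      (fun _ _ h => h)
  refine .seq (R := I 0) (.block hs ?_ ?_) fun s₁ hs₁ h₁ =>
    .seq (.loop I m hs₁ h₁ ?_) fun s₂ hs₂ h₂ => .block hs₂ ?_ ?_
  · simp [FitsBlock, Instr.Fits]
  · refine ⟨⟨?_, ?_, ?_⟩, ?_, ?_, ?_, ?_, ?_, ?_⟩ <;>
      simp +contextual [execBlock, Instr.exec, Function.update_apply, ho]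
    intro i hi; omega
  · rintro k t ht ⟨hst, h7, h8, hk, h1, h2, h5⟩ hlt
    have hm' : t.natReg 1 = m := by rw [hst.natReg 1 (by norm_num), hm]
    have hone' : t.natReg 2 = 1 := by rw [hst.natReg 2 (by norm_num), hone]
    simp only [Test.Holds, h8, hm'] at hlt
    refine ⟨hlt, .block ht ?_ ?_⟩
    · simp [FitsBlock, Instr.Fits, Instr.exec, hone', h7, h8]
      omega
    · have hpk : t.realArr a (o + k) = p k := by rw [hst.realArr a ha5 ha6, hp k hlt]
      refine ⟨⟨?_, ?_, ?_⟩, ?_, ?_, hlt, ?_, ?_, ?_⟩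
      · simp [execBlock, Instr.exec, hst.natArr]
      · intro b hb5 hb6
        simp [execBlock, Instr.exec, hb5, hst.realArr b hb5 hb6]
      · intro i hi
        have : i ≠ 7 := by omega
        have : i ≠ 8 := by omega
        simp [execBlock, Instr.exec, *, hst.natReg i hi]
      · simp [execBlock, Instr.exec, hone', h7, add_assoc]
      · simp [execBlock, Instr.exec, hone', h8]
      · simp [execBlock, Instr.exec, h7, hpk, h1, Finset.sum_range_succ, pow_two]
      · simp [execBlock, Instr.exec, h2]
      · intro l hl
        simp only [execBlock, Instr.exec, Function.update_apply]
        by_cases hlk : l = k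
        · simp [h8, h7, hpk, h2, hlk, mul_comm]
        · simp [h8, hlk, h5 l (by omega)]
  · obtain ⟨k, ⟨hst, h7, h8, hk, h1, h2, h5⟩, hlt⟩ := h₂
    have hone' : s₂.natReg 2 = 1 := by rw [hst.natReg 2 (by norm_num), hone]
    simp only [Test.Holds, h8, hst.natReg 1 (by norm_num), hm] at hlt
    simp [FitsBlock, Instr.Fits, Instr.exec, hone', h8]
    omega
  · obtain ⟨k, ⟨hst, h7, h8, hk, h1, h2, h5⟩, hlt⟩ := h₂
    have hone' : s₂.natReg 2 = 1 := by rw [hst.natReg 2 (by norm_num), hone]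
    simp only [Test.Holds, h8, hst.natReg 1 (by norm_num), hm] at hlt
    obtain rfl : k = m := by omega
    refine ⟨⟨?_, ?_, ?_⟩, ?_, ?_⟩
    · simp [execBlock, Instr.exec, hst.natArr]
    · intro b hb5 hb6
      simp [execBlock, Instr.exec, hb5, hst.realArr b hb5 hb6]
    · intro i hi
      have : i ≠ 8 := by omega
      simp [execBlock, Instr.exec, *, hst.natReg i hi]
    · simp [execBlock, Instr.exec, h7]
    · intro l hl
      simp only [execBlock, Instr.exec, Function.update_apply]
      rcases Nat.lt_or_ge l k with h | h
      · have : l ≠ k := by omega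
        have : l ≠ k + 1 := by omega
        simp [*, liftPoint]
      · obtain rfl | rfl : l = k ∨ l = k + 1 := by omega
        · simp [h8, hone', h1, liftPoint]
        · simp [h8, hone', h1, liftPoint]

/-- Evaluate all monomials of the tables at the point stored in the real array `5`, and store their
values in the real array `6`. -/
def evalMonomials : Program :=
  (Program.block [.setNat 8 0, .setReal 1 1, .writeReal 6 8 1, .addNat 8 8 2]).seq <|
  .while (.natLt 8 5) (Program.block [.readNat 9 0 8, .readReal 1 6 9, .readNat 9 1 8,
    .readReal 2 5 9, .mulReal 1 1 2, .writeReal 6 8 1, .addNat 8 8 2])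

/-- Since `par e < e`, the value at the parent is already in the table, and one multiplication by a
coordinate yields the next value. -/
theorem evalMonomials_ensures {s : State} {B M N : ℕ} {mu : ℕ → ℕ → ℕ}
    (hs : s.BoundedBy B) (hone : s.natReg 2 = 1) (hN : s.natReg 5 = N)
    (hT : IsMonomialTree M N (s.natArr 0) (s.natArr 1) mu) (hB : N ≤ B) :
    evalMonomials.Ensures B (9 * N + 6) s (fun s' =>
      SameTables s s' ∧ s'.natReg 7 = s.natReg 7 ∧
      ∀ e < N, s'.realArr 6 e = monomialAt M (s.realArr 5) (mu e)) := by
  -- After k rounds k + 1 values are present, because the constant monomial is written before the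
  -- loop.
  let I : ℕ → State → Prop := fun k s' =>
    SameTables s s' ∧ s'.natReg 7 = s.natReg 7 ∧ s'.realArr 5 = s.realArr 5 ∧
    s'.natReg 8 = k + 1 ∧ k + 1 ≤ N ∧
    ∀ e < k + 1, s'.realArr 6 e = monomialAt M (s.realArr 5) (mu e)
  have hpos := hT.pos
  refine Program.Ensures.mono (k := (4 + 1) + (N * ((7 + 1) + 1) + 1))
    (Q := fun s' => SameTables s s' ∧ s'.natReg 7 = s.natReg 7 ∧
      ∀ e < N, s'.realArr 6 e = monomialAt M (s.realArr 5) (mu e))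
    (.seq (R := I 0) (.block hs ?_ ?_) fun s₁ hs₁ h₁ => .loop I N hs₁ h₁ ?_) (by omega) ?_
  · simp [FitsBlock, Instr.Fits, Instr.exec, hone]
    omega
  · refine ⟨⟨?_, ?_, ?_⟩, ?_, ?_, ?_, by omega, ?_⟩
    · simp [execBlock, Instr.exec]
    · intro b hb5 hb6
      simp [execBlock, Instr.exec, hb6]
    · intro i hi
      have : i ≠ 8 := by omega
      simp [execBlock, Instr.exec, *]
    · simp [execBlock, Instr.exec]
    · simp [execBlock, Instr.exec]
    · simp [execBlock, Instr.exec, hone]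
    · intro e he
      obtain rfl : e = 0 := by omega
      simp [execBlock, Instr.exec, hT.root, monomialAt_zero]
  · rintro k t ht ⟨hst, h7, h5, h8, hk, h6⟩ hlt
    have hone' : t.natReg 2 = 1 := by rw [hst.natReg 2 (by norm_num), hone]
    have hN' : t.natReg 5 = N := by rw [hst.natReg 5 (by norm_num), hN]
    simp only [Test.Holds, h8, hN'] at hlt
    refine ⟨by omega, .block ht ?_ ?_⟩
    · simp [FitsBlock, Instr.Fits, Instr.exec, hone', h8]
      omega
    · refine ⟨⟨?_, ?_, ?_⟩, ?_, ?_, ?_, hlt, ?_⟩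
      · simp [execBlock, Instr.exec, hst.natArr]
      · intro b hb5 hb6
        simp [execBlock, Instr.exec, hb6, hst.realArr b hb5 hb6]
      · intro i hi
        have : i ≠ 9 := by omega
        have : i ≠ 8 := by omega
        simp [execBlock, Instr.exec, *, hst.natReg i hi]
      · simp [execBlock, Instr.exec, h7]
      · simp [execBlock, Instr.exec, h5]
      · simp [execBlock, Instr.exec, hone', h8]
      · intro e he
        simp only [execBlock, Instr.exec, Function.update_apply]
        by_cases hek : e = k + 1
        · subst hek
          have hp := hT.par_lt _ hlt (by omega)
          have := h6 _ hp
          rw [hT.mu_eq _ hlt (by omega), monomialAt_add_single (hT.lett_lt _ hlt (by omega)),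
            ← this]
          simp [h8, hst.natArr, h5]
        · simp [h8, hek, h6 e (by omega)]
  · rintro s' - ⟨k, ⟨hst, h7, h5, h8, hk, h6⟩, hlt⟩
    simp only [Test.Holds, h8, hst.natReg 5 (by norm_num), hN] at hlt
    exact ⟨hst, h7, fun e he => h6 e (by omega)⟩

end RealRAM

/-! ### Moments of the sources and potentials at the targets -/

namespace RealRAM

/-- Load a point and evaluate all monomials there. -/
def evalPoint (a : ℕ) (c A₁ B₁ A₂ B₂ : ℚ) : Program :=
  (loadPoint a c A₁ B₁ A₂ B₂).seq evalMonomials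

theorem evalPoint_ensures {s : State} {B a m o N : ℕ} {mu : ℕ → ℕ → ℕ} (c A₁ B₁ A₂ B₂ : ℚ)
    {p : ℕ → ℝ} (hs : s.BoundedBy B) (ha5 : a ≠ 5) (ha6 : a ≠ 6) (hone : s.natReg 2 = 1)
    (hm : s.natReg 1 = m) (ho : s.natReg 7 = o) (hN : s.natReg 5 = N)
    (hT : IsMonomialTree (m + 2) N (s.natArr 0) (s.natArr 1) mu)
    (hp : ∀ l < m, s.realArr a (o + l) = p l) (hB : o + m + 2 ≤ B) (hNB : N ≤ B) :
    (evalPoint a c A₁ B₁ A₂ B₂).Ensures B (9 * m + 9 * N + 23) s (fun s' =>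
      SameTables s s' ∧ s'.natReg 7 = o + m ∧
      ∀ e < N, s'.realArr 6 e = monomialAt (m + 2) (liftPoint m c A₁ B₁ A₂ B₂ p) (mu e)) := by
  refine Program.Ensures.mono (k := (9 * m + 17) + (9 * N + 6))
    (.seq (loadPoint_ensures c A₁ B₁ A₂ B₂ hs ha5 ha6 hone hm ho hp hB) fun s₁ hs₁ h₁ =>
      .mono (evalMonomials_ensures (M := m + 2) (N := N) (mu := mu) hs₁ ?_ ?_ ?_ hNB) le_rfl
        (Q := fun s' => SameTables s s' ∧ s'.natReg 7 = o + m ∧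
          ∀ e < N, s'.realArr 6 e = monomialAt (m + 2) (liftPoint m c A₁ B₁ A₂ B₂ p) (mu e)) ?_)
    (by omega) fun _ _ h => h
  · rw [h₁.1.natReg 2 (by norm_num), hone]
  · rw [h₁.1.natReg 5 (by norm_num), hN]
  · rwa [h₁.1.natArr]
  · rintro s' - ⟨hst, h7, h6⟩
    refine ⟨h₁.1.trans hst, h7.trans h₁.2.1, fun e he => (h6 e he).trans ?_⟩
    refine Finset.prod_congr rfl fun l hl => ?_
    rw [h₁.2.2 l (Finset.mem_range.1 hl)]

/-- For each monomial, sum the products of the weights with the values at the sources. -/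
def computeMoments (c A₁ B₁ A₂ B₂ : ℚ) : Program :=
  (Program.block [.setNat 6 0, .setNat 7 0]).seq <|
  .while (.natLt 6 0) <|
    (evalPoint 1 c A₁ B₁ A₂ B₂).seq <|
    (Program.block [.readReal 5 2 6, .setNat 8 0]).seq <|
    (Program.while (.natLt 8 5) (Program.block [.readReal 1 6 8, .mulReal 1 1 5, .readReal 2 7 8,
      .addReal 1 1 2, .writeReal 7 8 1, .addNat 8 8 2])).seq <|
    Program.block [.addNat 6 6 2]

/-- The moments accumulate in place in array 7, which therefore has to start as zero. -/
theorem computeMoments_ensures {s : State} {B n m N : ℕ} {mu : ℕ → ℕ → ℕ} (c A₁ B₁ A₂ B₂ : ℚ)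
    {p : ℕ → ℕ → ℝ} (hs : s.BoundedBy B) (hn : s.natReg 0 = n) (hm : s.natReg 1 = m)
    (hone : s.natReg 2 = 1) (hN : s.natReg 5 = N)
    (hT : IsMonomialTree (m + 2) N (s.natArr 0) (s.natArr 1) mu)
    (hp : ∀ j < n, ∀ l < m, s.realArr 1 (j * m + l) = p j l) (h7 : ∀ e < N, s.realArr 7 e = 0)
    (hB : n * m + n + m + 2 ≤ B) (hNB : N ≤ B) :
    (computeMoments c A₁ B₁ A₂ B₂).Ensures B (n * (9 * m + 17 * N + 30) + 4) s (fun s' =>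
      s'.natArr = s.natArr ∧ (∀ a, a ≠ 5 → a ≠ 6 → a ≠ 7 → s'.realArr a = s.realArr a) ∧
      (∀ i < 6, s'.natReg i = s.natReg i) ∧
      ∀ e < N, s'.realArr 7 e = ∑ j ∈ Finset.range n, s.realArr 2 j *
        monomialAt (m + 2) (liftPoint m c A₁ B₁ A₂ B₂ (p j)) (mu e)) := by
  let V : ℕ → ℕ → ℝ := fun j e => monomialAt (m + 2) (liftPoint m c A₁ B₁ A₂ B₂ (p j)) (mu e)
  let F : State → Prop := fun s' =>
    s'.natArr = s.natArr ∧ (∀ a, a ≠ 5 → a ≠ 6 → a ≠ 7 → s'.realArr a = s.realArr a) ∧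
      (∀ i < 6, s'.natReg i = s.natReg i)
  let I : ℕ → State → Prop := fun k s' =>
    F s' ∧ s'.natReg 6 = k ∧ s'.natReg 7 = k * m ∧ k ≤ n ∧
    ∀ e < N, s'.realArr 7 e = ∑ j ∈ Finset.range k, s.realArr 2 j * V j e
  -- While source k is being added, the entries below i already include it and those from i on do
  -- not yet.
  let J : ℕ → ℕ → State → Prop := fun k i s' =>
    F s' ∧ s'.natReg 6 = k ∧ s'.natReg 7 = (k + 1) * m ∧ s'.natReg 8 = i ∧ i ≤ N ∧
    s'.realReg 5 = s.realArr 2 k ∧ (∀ e < N, s'.realArr 6 e = V k e) ∧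
    (∀ e < i, s'.realArr 7 e = ∑ j ∈ Finset.range (k + 1), s.realArr 2 j * V j e) ∧
    (∀ e, i ≤ e → e < N → s'.realArr 7 e = ∑ j ∈ Finset.range k, s.realArr 2 j * V j e)
  refine Program.Ensures.mono
    (k := (2 + 1) + (n * (((9 * m + 9 * N + 23) + ((2 + 1) + ((N * ((6 + 1) + 1) + 1) +
      (1 + 1)))) + 1) + 1))
    (.seq (R := I 0) (.block hs ?_ ?_) fun s₁ hs₁ h₁ => .loop I n hs₁ h₁ ?_)
    (by ring_nf; omega) ?_
  · simp [FitsBlock, Instr.Fits]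
  · refine ⟨⟨?_, ?_, ?_⟩, ?_, ?_, by omega, ?_⟩
    · simp [execBlock, Instr.exec]
    · intros; simp [execBlock, Instr.exec]
    · intro i hi
      have : i ≠ 6 := by omega
      have : i ≠ 7 := by omega
      simp [execBlock, Instr.exec, *]
    · simp [execBlock, Instr.exec]
    · simp [execBlock, Instr.exec]
    · simpa [execBlock, Instr.exec] using h7
  · rintro k t ht ⟨hF, hk6, hk7, hk, hsum⟩ hlt
    simp only [Test.Holds, hk6, hF.2.2 0 (by norm_num), hn] at hlt
    have hkm : k * m + m + 2 ≤ B := by nlinarith [Nat.mul_le_mul_right m hlt]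
    refine ⟨hlt, .seq (evalPoint_ensures (N := N) (mu := mu) (p := p k) c A₁ B₁ A₂ B₂ ht
      (by norm_num) (by norm_num) (by rw [hF.2.2 2 (by norm_num), hone])
      (by rw [hF.2.2 1 (by norm_num), hm]) hk7 (by rw [hF.2.2 5 (by norm_num), hN])
      (by rwa [hF.1]) ?_ hkm hNB) fun t₁ ht₁ h₁ => ?_⟩
    · intro l hl
      rw [hF.2.1 1 (by norm_num) (by norm_num) (by norm_num), hp k hlt l hl]
    obtain ⟨hst, h17, h16⟩ := h₁
    have hF₁ : F t₁ := ⟨hst.natArr.trans hF.1,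
      fun a h5 h6 h7 => (hst.realArr a h5 h6).trans (hF.2.1 a h5 h6 h7),
      fun i hi => (hst.natReg i (by omega)).trans (hF.2.2 i hi)⟩
    refine .seq (R := J k 0) (.block ht₁ ?_ ?_) fun t₂ ht₂ h₂ =>
      .seq (.loop (J k) N ht₂ h₂ ?_) fun t₃ ht₃ h₃ => .block ht₃ ?_ ?_
    · simp [FitsBlock, Instr.Fits]
    · refine ⟨⟨?_, ?_, ?_⟩, ?_, ?_, ?_, by omega, ?_, ?_, by simp, ?_⟩
      · simp [execBlock, Instr.exec, hF₁.1]
      · intro a h5 h6 h7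
        simp [execBlock, Instr.exec, hF₁.2.1 a h5 h6 h7]
      · intro i hi
        have : i ≠ 8 := by omega
        simp [execBlock, Instr.exec, *, hF₁.2.2 i hi]
      · simp [execBlock, Instr.exec, hst.natReg 6 (by norm_num), hk6]
      · simp [execBlock, Instr.exec, h17, add_mul]
      · simp [execBlock, Instr.exec]
      · simp [execBlock, Instr.exec, hst.natReg 6 (by norm_num), hk6,
          hF₁.2.1 2 (by norm_num) (by norm_num) (by norm_num)]
      · simpa [execBlock, Instr.exec] using h16
      · intro e _ he
        simp [execBlock, Instr.exec, hst.realArr 7 (by norm_num) (by norm_num), hsum e he]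
    · rintro i u hu ⟨hFu, hu6, hu7, hu8, hi, hu5, hV, hlo, hhi⟩ hlt
      have hone' : u.natReg 2 = 1 := by rw [hFu.2.2 2 (by norm_num), hone]
      simp only [Test.Holds, hu8, hFu.2.2 5 (by norm_num), hN] at hlt
      refine ⟨hlt, .block hu ?_ ?_⟩
      · simp [FitsBlock, Instr.Fits, Instr.exec, hone', hu8]
        omega
      · refine ⟨⟨?_, ?_, ?_⟩, ?_, ?_, ?_, hlt, ?_, ?_, ?_, ?_⟩
        · simp [execBlock, Instr.exec, hFu.1]
        · intro a h5 h6 h7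
          simp [execBlock, Instr.exec, h7, hFu.2.1 a h5 h6 h7]
        · intro i hi
          have : i ≠ 8 := by omega
          simp [execBlock, Instr.exec, *, hFu.2.2 i hi]
        · simp [execBlock, Instr.exec, hu6]
        · simp [execBlock, Instr.exec, hu7]
        · simp [execBlock, Instr.exec, hu8, hone']
        · simp [execBlock, Instr.exec, hu5]
        · simpa [execBlock, Instr.exec] using hV
        · intro e he
          simp only [execBlock, Instr.exec, Function.update_apply]
          by_cases hei : e = i
          · subst hei
            simp [hu8, hu5, hV e hlt, hhi e le_rfl hlt, Finset.sum_range_succ, mul_comm, add_comm]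
          · simp [hu8, hei, hlo e (by omega)]
        · intro e he he'
          have hei : e ≠ i := by omega
          simp [execBlock, Instr.exec, hu8, hei, hhi e (by omega) he']
    · obtain ⟨i, ⟨hFu, hu6, hu7, hu8, hi, hu5, hV, hlo, hhi⟩, hlt'⟩ := h₃
      have hone' : t₃.natReg 2 = 1 := by rw [hFu.2.2 2 (by norm_num), hone]
      simp [FitsBlock, Instr.Fits, hone', hu6]
      omega
    · obtain ⟨i, ⟨hFu, hu6, hu7, hu8, hi, hu5, hV, hlo, hhi⟩, hlt'⟩ := h₃
      have hone' : t₃.natReg 2 = 1 := by rw [hFu.2.2 2 (by norm_num), hone]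
      simp only [Test.Holds, hu8, hFu.2.2 5 (by norm_num), hN] at hlt'
      refine ⟨⟨?_, ?_, ?_⟩, ?_, ?_, hlt, ?_⟩
      · simp [execBlock, Instr.exec, hFu.1]
      · intro a h5 h6 h7
        simp [execBlock, Instr.exec, hFu.2.1 a h5 h6 h7]
      · intro i hi
        have : i ≠ 6 := by omega
        simp [execBlock, Instr.exec, *, hFu.2.2 i hi]
      · simp [execBlock, Instr.exec, hu6, hone']
      · simp [execBlock, Instr.exec, hu7]
      · intro e he
        simp [execBlock, Instr.exec, hlo e (by omega)]
  · rintro s' - ⟨k, ⟨hF, hk6, hk7, hk, hsum⟩, hlt⟩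
    simp only [Test.Holds, hk6, hF.2.2 0 (by norm_num), hn] at hlt
    obtain rfl : k = n := by omega
    exact ⟨hF.1, hF.2.1, hF.2.2, hsum⟩

/-- For each target, sum the products of the weights and the moments of the monomials with their
values at the target. -/
def computePotentials (c A₁ B₁ A₂ B₂ : ℚ) : Program :=
  (Program.block [.setNat 6 0, .setNat 7 0]).seq <|
  .while (.natLt 6 0) <|
    (evalPoint 0 c A₁ B₁ A₂ B₂).seq <|
    (Program.block [.setReal 5 0, .setNat 8 0]).seq <|
    (Program.while (.natLt 8 5) (Program.block [.readReal 1 6 8, .readReal 2 7 8, .mulReal 1 1 2,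
      .readReal 2 8 8, .mulReal 1 1 2, .addReal 5 5 1, .addNat 8 8 2])).seq <|
    Program.block [.writeReal 3 6 5, .addNat 6 6 2]

/-- Array 7 supplies the moments and array 8 the coefficients of the monomials. Only the output
matters afterwards, so nothing is claimed about the rest of the memory. -/
theorem computePotentials_ensures {s : State} {B n m N : ℕ} {mu : ℕ → ℕ → ℕ}
    (c A₁ B₁ A₂ B₂ : ℚ) {p : ℕ → ℕ → ℝ} (hs : s.BoundedBy B) (hn : s.natReg 0 = n)
    (hm : s.natReg 1 = m) (hone : s.natReg 2 = 1) (hN : s.natReg 5 = N)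
    (hT : IsMonomialTree (m + 2) N (s.natArr 0) (s.natArr 1) mu)
    (hp : ∀ j < n, ∀ l < m, s.realArr 0 (j * m + l) = p j l)
    (hB : n * m + n + m + 2 ≤ B) (hNB : N ≤ B) :
    (computePotentials c A₁ B₁ A₂ B₂).Ensures B (n * (9 * m + 18 * N + 31) + 4) s (fun s' =>
      ∀ i < n, s'.realArr 3 i = ∑ e ∈ Finset.range N,
        monomialAt (m + 2) (liftPoint m c A₁ B₁ A₂ B₂ (p i)) (mu e) * s.realArr 7 e *
          s.realArr 8 e) := by
  let V : ℕ → ℕ → ℝ := fun j e => monomialAt (m + 2) (liftPoint m c A₁ B₁ A₂ B₂ (p j)) (mu e)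
  let F : State → Prop := fun s' =>
    s'.natArr = s.natArr ∧ (∀ a, a ≠ 3 → a ≠ 5 → a ≠ 6 → s'.realArr a = s.realArr a) ∧
      (∀ i < 6, s'.natReg i = s.natReg i)
  let I : ℕ → State → Prop := fun k s' =>
    F s' ∧ s'.natReg 6 = k ∧ s'.natReg 7 = k * m ∧ k ≤ n ∧
    ∀ j < k, s'.realArr 3 j = ∑ e ∈ Finset.range N, V j e * s.realArr 7 e * s.realArr 8 e
  let J : ℕ → ℕ → State → Prop := fun k i s' =>
    F s' ∧ s'.natReg 6 = k ∧ s'.natReg 7 = (k + 1) * m ∧ s'.natReg 8 = i ∧ i ≤ N ∧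
    (∀ e < N, s'.realArr 6 e = V k e) ∧
    s'.realReg 5 = ∑ e ∈ Finset.range i, V k e * s.realArr 7 e * s.realArr 8 e ∧
    ∀ j < k, s'.realArr 3 j = ∑ e ∈ Finset.range N, V j e * s.realArr 7 e * s.realArr 8 e
  refine Program.Ensures.mono
    (k := (2 + 1) + (n * (((9 * m + 9 * N + 23) + ((2 + 1) + ((N * ((7 + 1) + 1) + 1) +
      (2 + 1)))) + 1) + 1))
    (.seq (R := I 0) (.block hs ?_ ?_) fun s₁ hs₁ h₁ => .loop I n hs₁ h₁ ?_)
    (by ring_nf; omega) ?_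
  · simp [FitsBlock, Instr.Fits]
  · refine ⟨⟨?_, ?_, ?_⟩, ?_, ?_, by omega, by simp⟩
    · simp [execBlock, Instr.exec]
    · intros; simp [execBlock, Instr.exec]
    · intro i hi
      have : i ≠ 6 := by omega
      have : i ≠ 7 := by omega
      simp [execBlock, Instr.exec, *]
    · simp [execBlock, Instr.exec]
    · simp [execBlock, Instr.exec]
  · rintro k t ht ⟨hF, hk6, hk7, hk, hsum⟩ hlt
    simp only [Test.Holds, hk6, hF.2.2 0 (by norm_num), hn] at hlt
    have hkm : k * m + m + 2 ≤ B := by nlinarith [Nat.mul_le_mul_right m hlt]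
    refine ⟨hlt, .seq (evalPoint_ensures (N := N) (mu := mu) (p := p k) c A₁ B₁ A₂ B₂ ht
      (by norm_num) (by norm_num) (by rw [hF.2.2 2 (by norm_num), hone])
      (by rw [hF.2.2 1 (by norm_num), hm]) hk7 (by rw [hF.2.2 5 (by norm_num), hN])
      (by rwa [hF.1]) ?_ hkm hNB) fun t₁ ht₁ h₁ => ?_⟩
    · intro l hl
      rw [hF.2.1 0 (by norm_num) (by norm_num) (by norm_num), hp k hlt l hl]
    obtain ⟨hst, h17, h16⟩ := h₁
    have hF₁ : F t₁ := ⟨hst.natArr.trans hF.1,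
      fun a h3 h5 h6 => (hst.realArr a h5 h6).trans (hF.2.1 a h3 h5 h6),
      fun i hi => (hst.natReg i (by omega)).trans (hF.2.2 i hi)⟩
    refine .seq (R := J k 0) (.block ht₁ ?_ ?_) fun t₂ ht₂ h₂ =>
      .seq (.loop (J k) N ht₂ h₂ ?_) fun t₃ ht₃ h₃ => .block ht₃ ?_ ?_
    · simp [FitsBlock, Instr.Fits]
    · refine ⟨⟨?_, ?_, ?_⟩, ?_, ?_, ?_, by omega, ?_, ?_, ?_⟩
      · simp [execBlock, Instr.exec, hF₁.1]
      · intro a h3 h5 h6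
        simp [execBlock, Instr.exec, hF₁.2.1 a h3 h5 h6]
      · intro i hi
        have : i ≠ 8 := by omega
        simp [execBlock, Instr.exec, *, hF₁.2.2 i hi]
      · simp [execBlock, Instr.exec, hst.natReg 6 (by norm_num), hk6]
      · simp [execBlock, Instr.exec, h17, add_mul]
      · simp [execBlock, Instr.exec]
      · simpa [execBlock, Instr.exec] using h16
      · simp [execBlock, Instr.exec]
      · intro j hj
        simp [execBlock, Instr.exec, hst.realArr 3 (by norm_num) (by norm_num), hsum j hj]
    · rintro i u hu ⟨hFu, hu6, hu7, hu8, hi, hV, hu5, hout⟩ hlt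
      have hone' : u.natReg 2 = 1 := by rw [hFu.2.2 2 (by norm_num), hone]
      simp only [Test.Holds, hu8, hFu.2.2 5 (by norm_num), hN] at hlt
      refine ⟨hlt, .block hu ?_ ?_⟩
      · simp [FitsBlock, Instr.Fits, Instr.exec, hone', hu8]
        omega
      · refine ⟨⟨?_, ?_, ?_⟩, ?_, ?_, ?_, hlt, ?_, ?_, ?_⟩
        · simp [execBlock, Instr.exec, hFu.1]
        · intro a h3 h5 h6
          simp [execBlock, Instr.exec, hFu.2.1 a h3 h5 h6]
        · intro i hi
          have : i ≠ 8 := by omega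
          simp [execBlock, Instr.exec, *, hFu.2.2 i hi]
        · simp [execBlock, Instr.exec, hu6]
        · simp [execBlock, Instr.exec, hu7]
        · simp [execBlock, Instr.exec, hu8, hone']
        · simpa [execBlock, Instr.exec] using hV
        · simp [execBlock, Instr.exec, Finset.sum_range_succ, hu5, hu8, hV i hlt,
            hFu.2.1 7 (by norm_num) (by norm_num) (by norm_num),
            hFu.2.1 8 (by norm_num) (by norm_num) (by norm_num)]
        · simpa [execBlock, Instr.exec] using hout
    · obtain ⟨i, ⟨hFu, hu6, hu7, hu8, hi, hV, hu5, hout⟩, hlt'⟩ := h₃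
      have hone' : t₃.natReg 2 = 1 := by rw [hFu.2.2 2 (by norm_num), hone]
      simp [FitsBlock, Instr.Fits, Instr.exec, hone', hu6]
      omega
    · obtain ⟨i, ⟨hFu, hu6, hu7, hu8, hi, hV, hu5, hout⟩, hlt'⟩ := h₃
      have hone' : t₃.natReg 2 = 1 := by rw [hFu.2.2 2 (by norm_num), hone]
      simp only [Test.Holds, hu8, hFu.2.2 5 (by norm_num), hN] at hlt'
      obtain rfl : i = N := by omega
      refine ⟨⟨?_, ?_, ?_⟩, ?_, ?_, hlt, ?_⟩
      · simp [execBlock, Instr.exec, hFu.1]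
      · intro a h3 h5 h6
        simp [execBlock, Instr.exec, h3, hFu.2.1 a h3 h5 h6]
      · intro i hi
        have : i ≠ 6 := by omega
        simp [execBlock, Instr.exec, *, hFu.2.2 i hi]
      · simp [execBlock, Instr.exec, hu6, hone']
      · simp [execBlock, Instr.exec, hu7]
      · intro j hj
        simp only [execBlock, Instr.exec, Function.update_apply]
        by_cases hjk : j = k
        · simp [hu6, hu5, hjk]
        · simp [hu6, hjk, hout j (by omega)]
  · rintro s' - ⟨k, ⟨hF, hk6, hk7, hk, hsum⟩, hlt⟩
    simp only [Test.Holds, hk6, hF.2.2 0 (by norm_num), hn] at hlt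
    exact fun j hj => hsum j (by omega)

end RealRAM

/-! ### Enumeration of the monomials -/

namespace RealRAM

open Classical Finset in
/-- The multi-indices of degree at most `q` in the variables `0, …, M - 1`. -/
noncomputable def multiIndices (M q : ℕ) : Finset (ℕ → ℕ) :=
  (range (q + 1)).biUnion fun k => piAntidiag (range M) k

theorem mem_multiIndices {M q : ℕ} {μ : ℕ → ℕ} :
    μ ∈ multiIndices M q ↔ ∑ i ∈ Finset.range M, μ i ≤ q ∧ ∀ i, μ i ≠ 0 → i < M := by
  simp only [multiIndices, Finset.mem_biUnion, Finset.mem_range, Finset.mem_piAntidiag]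
  constructor
  · rintro ⟨k, hk, rfl, h⟩
    exact ⟨Nat.lt_succ_iff.1 hk, h⟩
  · rintro ⟨hs, h⟩
    exact ⟨_, Nat.lt_succ_iff.2 hs, rfl, h⟩

/-- There are `M.multichoose k` multi-indices of degree exactly k, and these numbers sum to a
binomial coefficient. -/
theorem card_multiIndices_le (M q : ℕ) : (multiIndices M q).card ≤ (M + q).choose q := by
  have hcard (k : ℕ) : (Finset.piAntidiag (Finset.range M) k).card = M.multichoose k := by
    have := Finset.card_finsuppAntidiag_nat_eq_multichoose (s := Finset.range M) k
    simpa [Finset.finsuppAntidiag] using this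
  calc (multiIndices M q).card
      ≤ ∑ k ∈ Finset.range (q + 1), (Finset.piAntidiag (Finset.range M) k).card := by
        classical
        unfold multiIndices
        exact Finset.card_biUnion_le
    _ = (M + q).choose q := by
        simp_rw [hcard, Nat.sum_range_multichoose]
        rw [add_comm, Nat.choose_symm_add]

theorem sum_add_single {M l : ℕ} (hl : l < M) (μ : ℕ → ℕ) :
    ∑ i ∈ Finset.range M, (μ + Pi.single l 1 : ℕ → ℕ) i = ∑ i ∈ Finset.range M, μ i + 1 := by
  have hsum : ∑ i ∈ Finset.range M, (Pi.single l 1 : ℕ → ℕ) i = 1 := by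
    rw [Finset.sum_eq_single_of_mem l (Finset.mem_range.2 hl)] <;> simp +contextual
  simp only [Pi.add_apply, Finset.sum_add_distrib, hsum]

/-- This recursion lets the machine obtain each inverse factorial product from that of the parent by
one division. -/
theorem prod_factorial_add_single {M l : ℕ} (hl : l < M) (μ : ℕ → ℕ) :
    ∏ i ∈ Finset.range M, (((μ + Pi.single l 1 : ℕ → ℕ) i).factorial : ℝ) =
      (∏ i ∈ Finset.range M, ((μ i).factorial : ℝ)) * (μ l + 1) := by
  have : ∀ i ∈ Finset.range M, (((μ + Pi.single l 1 : ℕ → ℕ) i).factorial : ℝ) =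
      (μ i).factorial * (if i = l then (μ i + 1 : ℝ) else 1) := by
    intro i _
    by_cases h : i = l
    · subst h; simp [Nat.factorial_succ, mul_comm]
    · simp [h]
  rw [Finset.prod_congr rfl this, Finset.prod_mul_distrib, Finset.prod_ite_eq']
  simp [hl]

/-- The tables list the multi-indices `mu e`, `e < N`, among them all those of degree at most `q` in
the variables `0, …, l - 1`. The variable `l` is being introduced: so far the numbers `e < h` have
been treated. -/
structure Lists (M q l h N : ℕ) (par lett deg : ℕ → ℕ) (cnt fac : ℕ → ℝ) (mu : ℕ → ℕ → ℕ) :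
    Prop where
  tree : IsMonomialTree M N par lett mu
  mem : ∀ e < N, mu e ∈ multiIndices M q
  deg_eq : ∀ e < N, deg e = ∑ i ∈ Finset.range M, mu e i
  cnt_eq : ∀ e < N, cnt e = mu e (lett e)
  fac_eq : ∀ e < N, fac e = (∏ i ∈ Finset.range M, ((mu e i).factorial : ℝ))⁻¹
  lett_le : ∀ e < N, lett e ≤ l
  eq_zero : ∀ e < N, ∀ i, lett e < i → mu e i = 0
  inj : ∀ e < N, ∀ e' < N, mu e = mu e' → e = e'
  old : ∀ μ ∈ multiIndices l q, ∃ e < N, mu e = μ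
  closed : ∀ e < h, deg e < q → ∃ e' < N, mu e' = mu e + Pi.single l 1
  new : ∀ e < N, mu e l ≠ 0 → ∃ e' < h, mu e = mu e' + Pi.single l 1

namespace Lists

variable {M q l h N : ℕ} {par lett deg : ℕ → ℕ} {cnt fac : ℕ → ℝ} {mu : ℕ → ℕ → ℕ}

theorem init (M q : ℕ) {fac : ℕ → ℝ} (hfac : fac 0 = 1) :
    Lists M q 0 0 1 (fun _ => 0) (fun _ => 0) (fun _ => 0) (fun _ => 0) fac (fun _ => 0) where
  tree := ⟨by omega, rfl, by omega, by omega, by omega⟩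
  mem := by simp [mem_multiIndices]
  deg_eq := by simp
  cnt_eq := by simp
  fac_eq := by simpa using hfac
  lett_le := by simp
  eq_zero := by simp
  inj := by omega
  old μ hμ := by
    refine ⟨0, by omega, funext fun i => ?_⟩
    have := (mem_multiIndices.1 hμ).2 i
    by_contra h
    exact absurd (this fun h' => h h'.symm) (by omega)
  closed := by omega
  new := by simp

/-- The absence of repetitions bounds the length of the list, and hence the number of rounds of a
loop that runs over a growing list. -/
theorem card_le (H : Lists M q l h N par lett deg cnt fac mu) : N ≤ (multiIndices M q).card := by
  have := Finset.card_le_card_of_injOn (s := Finset.range N) (t := multiIndices M q) mu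
    (fun e he => H.mem e (by simpa using he))
    (fun e he e' he' => H.inj e (by simpa using he) e' (by simpa using he'))
  simpa using this

theorem sum_eq (H : Lists M q M h N par lett deg cnt fac mu) (f : (ℕ → ℕ) → ℝ) :
    ∑ e ∈ Finset.range N, f (mu e) = ∑ μ ∈ multiIndices M q, f μ := by
  refine Finset.sum_nbij mu (fun e he => H.mem e (by simpa using he))
    (fun e he e' he' => H.inj e (by simpa using he) e' (by simpa using he')) ?_ fun _ _ => rfl
  intro μ hμ
  obtain ⟨e, he, rfl⟩ := H.old μ hμ
  exact ⟨e, by simpa using he, rfl⟩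

/-- The exponent of the current variable is available without storing multi-indices: it is zero if
the last letter is an earlier variable, and the stored counter otherwise. -/
theorem cnt_add_one (H : Lists M q l h N par lett deg cnt fac mu) (hh : h < N) :
    (if lett h < l then 1 else cnt h + 1) = (mu h l + 1 : ℝ) := by
  split_ifs with hl
  · simp [H.eq_zero h hh l hl]
  · have := H.lett_le h hh
    rw [H.cnt_eq h hh, show lett h = l by omega]

theorem skip (H : Lists M q l h N par lett deg cnt fac mu) (hq : ¬ deg h < q) :
    Lists M q l (h + 1) N par lett deg cnt fac mu where
  __ := H
  closed e he hd := H.closed e (by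
    rcases Nat.lt_succ_iff_lt_or_eq.1 he with h' | rfl
    · exact h'
    · exact absurd hd hq) hd
  new e he hl := by
    obtain ⟨e', he', h'⟩ := H.new e he hl
    exact ⟨e', by omega, h'⟩

/-- The point is that the appended index is fresh. By `new`, a listed copy would arise from some
number e' < h by raising the exponent of l; cancelling gives `mu h = mu e'`, against injectivity. -/
theorem append (H : Lists M q l h N par lett deg cnt fac mu) (hl : l < M) (hh : h < N)
    (hq : deg h < q) :
    Lists M q l (h + 1) (N + 1) (Function.update par N h) (Function.update lett N l)
      (Function.update deg N (deg h + 1)) (Function.update cnt N (mu h l + 1))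
      (Function.update fac N (fac h / (mu h l + 1)))
      (Function.update mu N (mu h + Pi.single l 1)) := by
  have hlt : ∀ {e}, e < N + 1 → e = N ∨ e < N ∧ e ≠ N := by intro e he; omega
  have hhN : h ≠ N := hh.ne
  have hnew : ∀ e < N, mu e ≠ mu h + Pi.single l 1 := by
    intro e he heq
    obtain ⟨e', he', h'⟩ := H.new e he (by simp [heq])
    rw [heq] at h'
    exact absurd (H.inj h hh e' (by omega) (add_right_cancel h')) (by omega)
  refine ⟨⟨by omega, ?_, ?_, ?_, ?_⟩, ?_, ?_, ?_, ?_, ?_, ?_, ?_, ?_, ?_, ?_⟩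
  · rw [Function.update_of_ne H.tree.pos.ne, H.tree.root]
  · intro e he h0
    obtain rfl | ⟨he, hne⟩ := hlt he
    · simpa using hh
    · simpa [hne] using H.tree.par_lt e he h0
  · intro e he h0
    obtain rfl | ⟨he, hne⟩ := hlt he
    · simpa using hl
    · simpa [hne] using H.tree.lett_lt e he h0
  · intro e he h0
    obtain rfl | ⟨he, hne⟩ := hlt he
    · simp [hhN]
    · have : par e ≠ N := (H.tree.par_lt e he h0).trans he |>.ne
      simpa [hne, this] using H.tree.mu_eq e he h0
  · intro e he
    obtain rfl | ⟨he, hne⟩ := hlt he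
    · rw [Function.update_self, mem_multiIndices, sum_add_single hl, ← H.deg_eq h hh]
      refine ⟨hq, fun i hi => ?_⟩
      by_cases hil : i = l
      · exact hil ▸ hl
      · exact (mem_multiIndices.1 (H.mem h hh)).2 i (by simpa [hil] using hi)
    · simpa [hne] using H.mem e he
  · intro e he
    obtain rfl | ⟨he, hne⟩ := hlt he
    · rw [Function.update_self, Function.update_self, sum_add_single hl, H.deg_eq h hh]
    · simpa [hne] using H.deg_eq e he
  · intro e he
    obtain rfl | ⟨he, hne⟩ := hlt he
    · simp
    · simpa [hne] using H.cnt_eq e he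
  · intro e he
    obtain rfl | ⟨he, hne⟩ := hlt he
    · rw [Function.update_self, Function.update_self, prod_factorial_add_single hl, mul_inv,
        H.fac_eq h hh, div_eq_mul_inv]
    · simpa [hne] using H.fac_eq e he
  · intro e he
    obtain rfl | ⟨he, hne⟩ := hlt he
    · simp
    · simpa [hne] using H.lett_le e he
  · intro e he i hi
    obtain rfl | ⟨he, hne⟩ := hlt he
    · simp only [Function.update_self] at hi ⊢
      simp [hi.ne', H.eq_zero h hh i ((H.lett_le h hh).trans_lt hi)]
    · simp only [Function.update_of_ne hne] at hi ⊢
      exact H.eq_zero e he i hi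
  · intro e he e' he' heq
    obtain rfl | ⟨he, hne⟩ := hlt he <;> obtain rfl | ⟨he', hne'⟩ := hlt he'
    · rfl
    · simp only [Function.update_self, Function.update_of_ne hne'] at heq
      exact absurd heq.symm (hnew e' he')
    · simp only [Function.update_self, Function.update_of_ne hne] at heq
      exact absurd heq (hnew e he)
    · simp only [Function.update_of_ne hne, Function.update_of_ne hne'] at heq
      exact H.inj e he e' he' heq
  · intro μ hμ
    obtain ⟨e, he, h'⟩ := H.old μ hμ
    exact ⟨e, by omega, by simpa [he.ne] using h'⟩
  · intro e he hd
    have heN : e ≠ N := by omega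
    rw [Function.update_of_ne heN] at hd
    rw [Function.update_of_ne heN]
    rcases Nat.lt_succ_iff_lt_or_eq.1 he with h' | rfl
    · obtain ⟨e', he', h''⟩ := H.closed e h' hd
      exact ⟨e', by omega, by simpa [he'.ne] using h''⟩
    · exact ⟨N, by omega, by simp⟩
  · intro e he hle
    obtain rfl | ⟨he, hne⟩ := hlt he
    · exact ⟨h, by omega, by simp [hhN]⟩
    · rw [Function.update_of_ne hne] at hle ⊢
      obtain ⟨e', he', h''⟩ := H.new e he hle
      have : e' ≠ N := by omega
      exact ⟨e', by omega, by simpa [this] using h''⟩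

/-- The pass for variable l also treats the numbers appended during that pass, so all powers of l
are reached. Completeness follows by induction on the exponent of l: lower it by one, find that
index in the list, and apply `closed`. -/
theorem next (H : Lists M q l N N par lett deg cnt fac mu) (hl : l < M) :
    Lists M q (l + 1) 0 N par lett deg cnt fac mu where
  __ := H
  lett_le e he := (H.lett_le e he).trans (Nat.le_succ l)
  closed := by omega
  new e he h := absurd (H.eq_zero e he (l + 1) (Nat.lt_succ_of_le (H.lett_le e he))) h
  old := by
    suffices ∀ k (μ : ℕ → ℕ), μ l = k → μ ∈ multiIndices (l + 1) q → ∃ e < N, mu e = μ from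
      fun μ => this _ μ rfl
    intro k
    induction k with
    | zero =>
      intro μ h0 hμ
      rw [mem_multiIndices, Finset.sum_range_succ, h0] at hμ
      refine H.old μ (mem_multiIndices.2 ⟨hμ.1, fun i hi => ?_⟩)
      have := hμ.2 i hi
      have : i ≠ l := by rintro rfl; exact hi h0
      omega
    | succ k ih =>
      intro μ hk hμ
      have hμ' : μ = Function.update μ l k + Pi.single l 1 := by
        funext i
        by_cases hi : i = l
        · subst hi; simp [hk]
        · simp [hi]
      rw [mem_multiIndices, hμ', sum_add_single (Nat.lt_add_one l)] at hμ
      obtain ⟨e, he, heq⟩ := ih (Function.update μ l k) (by simp) (mem_multiIndices.2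
        ⟨by omega, fun i hi => by
          by_cases hil : i = l
          · omega
          · exact hμ.2 i (by simpa [hil] using hi)⟩)
      obtain ⟨e', he', heq'⟩ := H.closed e he (by
        rw [H.deg_eq e he, heq]
        refine lt_of_lt_of_le (Nat.lt_succ_of_le ?_) hμ.1
        refine le_of_eq (Finset.sum_subset (by simpa using hl) fun i _ hi => ?_).symm
        have hi' : ¬ i < l + 1 := by simpa using hi
        by_contra h0
        exact hi' (hμ.2 i (by simp [h0])))
      exact ⟨e', he', by rw [heq', heq, ← hμ']⟩

end Lists

/-- List the multi-indices, variable by variable. -/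
def enumerate : Program :=
  (Program.block [.setNat 5 1, .setNat 6 0, .setReal 1 1, .writeReal 8 6 1]).seq <|
  .while (.natLt 6 3) <|
    (Program.block [.setNat 7 0]).seq <|
    (Program.while (.natLt 7 5) <|
      (Program.block [.readReal 1 4 7, .setReal 2 1, .readNat 9 1 7]).seq <|
      (Program.ite (.natLt 9 6) (Program.block [.setReal 1 1])
        (Program.block [.addReal 1 1 2])).seq <|
      (Program.block [.readNat 8 2 7]).seq <|
      (Program.ite (.natLt 8 4) (Program.block [.addNat 8 8 2, .writeNat 2 5 8, .writeNat 0 5 7,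
        .writeNat 1 5 6, .writeReal 4 5 1, .readReal 2 8 7, .divReal 2 2 1, .writeReal 8 5 2,
        .addNat 5 5 2]) (Program.block [])).seq <|
      Program.block [.addNat 7 7 2]).seq <|
    Program.block [.addNat 6 6 2]

/-- The tables in the memory list multi-indices in the sense of `Lists`. -/
def State.Lists (s : State) (M q l h N : ℕ) (mu : ℕ → ℕ → ℕ) : Prop :=
  RealRAM.Lists M q l h N (s.natArr 0) (s.natArr 1) (s.natArr 2) (s.realArr 4) (s.realArr 8) mu

theorem enumerate_ensures {s : State} {B M q D : ℕ} (hs : s.BoundedBy B) (hone : s.natReg 2 = 1)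
    (hM : s.natReg 3 = M) (hq : s.natReg 4 = q) (hnat : ∀ a p, s.natArr a p = 0)
    (h4 : ∀ p, s.realArr 4 p = 0)
    (hD : (multiIndices M q).card ≤ D) (hDB : D ≤ B) (hMB : M ≤ B) (hqB : q ≤ B) (hB : 1 ≤ B) :
    enumerate.Ensures B (M * (23 * D + 6) + 6) s (fun s' =>
      ∃ N mu, s'.natReg 5 = N ∧ s'.Lists M q M 0 N mu ∧ (∀ i < 5, s'.natReg i = s.natReg i) ∧
        ∀ a, a ≠ 4 → a ≠ 8 → s'.realArr a = s.realArr a) := by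
  let F : State → Prop := fun s' => (∀ i < 5, s'.natReg i = s.natReg i) ∧
    ∀ a, a ≠ 4 → a ≠ 8 → s'.realArr a = s.realArr a
  let I : ℕ → State → Prop := fun l s' =>
    F s' ∧ s'.natReg 6 = l ∧ l ≤ M ∧ ∃ N mu, s'.natReg 5 = N ∧ s'.Lists M q l 0 N mu
  -- The length N is existential because the inner loop extends the list it traverses.
  let J : ℕ → ℕ → State → Prop := fun l h s' =>
    F s' ∧ s'.natReg 6 = l ∧ s'.natReg 7 = h ∧
      ∃ N mu, s'.natReg 5 = N ∧ h ≤ N ∧ s'.Lists M q l h N mu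
  refine Program.Ensures.mono (k := (4 + 1) + (M * (((1 + 1) + ((D * (((3 + 1) + ((max (1 + 1) (1 + 1) + 1) +
      ((1 + 1) + ((max (9 + 1) (0 + 1) + 1) + (1 + 1))))) + 1) + 1) + (1 + 1))) + 1) + 1))
    (.seq (R := I 0) (.block hs ?_ ?_) fun s₁ hs₁ h₁ => .loop I M hs₁ h₁ ?_)
    (by norm_num; ring_nf; omega) ?_
  · simp [FitsBlock, Instr.Fits, hB]
  · refine ⟨⟨?_, ?_⟩, ?_, by omega, 1, fun _ => 0, ?_, ?_⟩
    · intro i hi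
      have : i ≠ 5 := by omega
      have : i ≠ 6 := by omega
      simp [execBlock, Instr.exec, *]
    · intro a h4 h8
      simp [execBlock, Instr.exec, *]
    · simp [execBlock, Instr.exec]
    · simp [execBlock, Instr.exec]
    · have : s.natArr = fun _ _ => 0 := funext fun a => funext fun p => hnat a p
      have h4' : s.realArr 4 = fun _ => 0 := funext h4
      simpa [execBlock, Instr.exec, State.Lists, this, h4'] using Lists.init M q (by simp)
  · rintro l t ht ⟨hF, hl, hlM, N, mu, hN, hL⟩ hlt
    simp only [Test.Holds, hl, hF.1 3 (by norm_num), hM] at hlt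
    refine ⟨hlt, .seq (R := J l 0) (.block ht ?_ ?_) fun t₁ ht₁ h₁ =>
      .seq (.loop (J l) D ht₁ h₁ ?_) fun t₂ ht₂ h₂ => .block ht₂ ?_ ?_⟩
    · simp [FitsBlock, Instr.Fits]
    · refine ⟨⟨?_, ?_⟩, ?_, ?_, N, mu, ?_, by omega, ?_⟩
      · intro i hi
        have : i ≠ 7 := by omega
        simp [execBlock, Instr.exec, *, hF.1 i hi]
      · intro a h4 h8
        simp [execBlock, Instr.exec, hF.2 a h4 h8]
      · simp [execBlock, Instr.exec, hl]
      · simp [execBlock, Instr.exec]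
      · simp [execBlock, Instr.exec, hN]
      · simpa [execBlock, Instr.exec, State.Lists] using hL
    · rintro h u hu ⟨hFu, hul, huh, N, mu, hN, hhN, hL⟩ hlt'
      simp only [Test.Holds, huh, hN] at hlt'
      have hND := hL.card_le.trans hD
      have hone' : u.natReg 2 = 1 := by rw [hFu.1 2 (by norm_num), hone]
      have hcnt := hL.cnt_add_one hlt'
      let K : State → Prop := fun s' => s'.natArr = u.natArr ∧ s'.realArr = u.realArr ∧
        (∀ i < 8, s'.natReg i = u.natReg i)
      refine ⟨by omega, .seq (R := fun s' => K s' ∧ s'.natReg 9 = u.natArr 1 h ∧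
        s'.realReg 1 = u.realArr 4 h ∧ s'.realReg 2 = 1) (.block hu ?_ ?_) fun u₁ hu₁ h₁ =>
        .seq (R := fun s' => K s' ∧ s'.realReg 1 = mu h l + 1)
          (.ite hu₁ (fun hc => .block hu₁ ?_ ?_) (fun hc => .block hu₁ ?_ ?_)) fun u₂ hu₂ h₂ =>
        .seq (R := fun s' => K s' ∧ s'.realReg 1 = mu h l + 1 ∧ s'.natReg 8 = u.natArr 2 h)
          (.block hu₂ ?_ ?_) fun u₃ hu₃ h₃ => .seq (R := fun s' => F s' ∧ s'.natReg 6 = l ∧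
            s'.natReg 7 = h ∧ ∃ N mu, s'.natReg 5 = N ∧ h < N ∧ s'.Lists M q l (h + 1) N mu)
          (.ite hu₃ (fun hc => .block hu₃ ?_ ?_) (fun hc => .block hu₃ ?_ ?_))
          fun u₄ hu₄ h₄ => .block hu₄ ?_ ?_⟩
      · simp [FitsBlock, Instr.Fits]
      · refine ⟨⟨?_, ?_, ?_⟩, ?_, ?_, ?_⟩
        · simp [execBlock, Instr.exec]
        · simp [execBlock, Instr.exec]
        · intro i hi
          have : i ≠ 9 := by omega
          simp [execBlock, Instr.exec, *]
        · simp [execBlock, Instr.exec, huh]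
        · simp [execBlock, Instr.exec, huh]
        · simp [execBlock, Instr.exec]
      · simp [FitsBlock, Instr.Fits]
      · obtain ⟨hK, h9, -, -⟩ := h₁
        simp only [Test.Holds, h9, hK.2.2 6 (by norm_num), hul] at hc
        rw [if_pos hc] at hcnt
        refine ⟨⟨?_, ?_, ?_⟩, ?_⟩
        · simp [execBlock, Instr.exec, hK.1]
        · simp [execBlock, Instr.exec, hK.2.1]
        · intro i hi
          simp [execBlock, Instr.exec, hK.2.2 i hi]
        · simp [execBlock, Instr.exec, ← hcnt]
      · simp [FitsBlock, Instr.Fits]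
      · obtain ⟨hK, h9, hr1, hr2⟩ := h₁
        simp only [Test.Holds, h9, hK.2.2 6 (by norm_num), hul] at hc
        rw [if_neg hc] at hcnt
        refine ⟨⟨?_, ?_, ?_⟩, ?_⟩
        · simp [execBlock, Instr.exec, hK.1]
        · simp [execBlock, Instr.exec, hK.2.1]
        · intro i hi
          simp [execBlock, Instr.exec, hK.2.2 i hi]
        · simp [execBlock, Instr.exec, ← hcnt, hr1, hr2]
      · simp [FitsBlock, Instr.Fits]
      · obtain ⟨hK, hr1⟩ := h₂
        refine ⟨⟨?_, ?_, ?_⟩, ?_, ?_⟩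
        · simp [execBlock, Instr.exec, hK.1]
        · simp [execBlock, Instr.exec, hK.2.1]
        · intro i hi
          have : i ≠ 8 := by omega
          simp [execBlock, Instr.exec, hK.2.2 i hi, *]
        · simp [execBlock, Instr.exec, hr1]
        · simp [execBlock, Instr.exec, hK.1, hK.2.2 7 (by norm_num), huh]
      · obtain ⟨⟨hKn, hKr, hKi⟩, hr1, h8⟩ := h₃
        simp only [Test.Holds, h8, hKi 4 (by norm_num), hFu.1 4 (by norm_num), hq] at hc
        simp [FitsBlock, Instr.Fits, Instr.exec, h8, hKi, hN, hone']
        -- The extended list is still free of repetitions, so N + 1 is at most D and the new length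
        -- fits.
        have := (hL.append hlt hlt' hc).card_le
        omega
      · obtain ⟨⟨hKn, hKr, hKi⟩, hr1, h8⟩ := h₃
        simp only [Test.Holds, h8, hKi 4 (by norm_num), hFu.1 4 (by norm_num), hq] at hc
        refine ⟨⟨?_, ?_⟩, ?_, ?_, N + 1,
          Function.update mu N (mu h + Pi.single l 1), ?_, ?_, ?_⟩
        · intro i hi
          have : i ≠ 5 := by omega
          have : i ≠ 8 := by omega
          simp [execBlock, Instr.exec, *, hKi i (by omega), hFu.1 i hi]
        · intro a h4 h8
          simp [execBlock, Instr.exec, h4, h8, hKr, hFu.2 a h4 h8]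
        · simp [execBlock, Instr.exec, hKi, hul]
        · simp [execBlock, Instr.exec, hKi, huh]
        · simp [execBlock, Instr.exec, hKi, hN, hone']
        · omega
        · simpa [execBlock, Instr.exec, State.Lists, hKi, hKn, hKr, hr1, h8, hN, huh, hul, hone']
            using hL.append hlt hlt' hc
      · simp [FitsBlock]
      · obtain ⟨⟨hKn, hKr, hKi⟩, hr1, h8⟩ := h₃
        simp only [Test.Holds, h8, hKi 4 (by norm_num), hFu.1 4 (by norm_num), hq] at hc
        refine ⟨⟨fun i hi => ?_, fun a h4 h8 => ?_⟩, ?_, ?_, N, mu, ?_, hlt', ?_⟩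
        · rw [execBlock, hKi i (by omega), hFu.1 i hi]
        · rw [execBlock, hKr, hFu.2 a h4 h8]
        · rw [execBlock, hKi 6 (by norm_num), hul]
        · rw [execBlock, hKi 7 (by norm_num), huh]
        · rw [execBlock, hKi 5 (by norm_num), hN]
        · simpa [execBlock, State.Lists, hKn, hKr] using hL.skip hc
      · obtain ⟨hF₄, h6, h7, N', mu', hN', hhN', hL'⟩ := h₄
        have := hL'.card_le
        simp [FitsBlock, Instr.Fits, h7, hF₄.1 2 (by norm_num), hone]
        omega
      · obtain ⟨hF₄, h6, h7, N', mu', hN', hhN', hL'⟩ := h₄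
        refine ⟨⟨fun i hi => ?_, fun a h4 h8 => ?_⟩, ?_, ?_, N', mu', ?_, hhN', ?_⟩
        · have : i ≠ 7 := by omega
          simp [execBlock, Instr.exec, this, hF₄.1 i hi]
        · simp [execBlock, Instr.exec, hF₄.2 a h4 h8]
        · simp [execBlock, Instr.exec, h6]
        · simp [execBlock, Instr.exec, h7, hF₄.1 2 (by norm_num), hone]
        · simp [execBlock, Instr.exec, hN']
        · simpa [execBlock, Instr.exec, State.Lists] using hL'
    · obtain ⟨h, ⟨hFu, hul, huh, N, mu, hN, hhN, hL⟩, hlt'⟩ := h₂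
      simp [FitsBlock, Instr.Fits, hul, hFu.1 2 (by norm_num), hone]
      omega
    · obtain ⟨h, ⟨hFu, hul, huh, N, mu, hN, hhN, hL⟩, hlt'⟩ := h₂
      simp only [Test.Holds, huh, hN] at hlt'
      obtain rfl : h = N := by omega
      refine ⟨⟨fun i hi => ?_, fun a h4 h8 => ?_⟩, ?_, hlt, h, mu, ?_, ?_⟩
      · have : i ≠ 6 := by omega
        simp [execBlock, Instr.exec, this, hFu.1 i hi]
      · simp [execBlock, Instr.exec, hFu.2 a h4 h8]
      · simp [execBlock, Instr.exec, hul, hFu.1 2 (by norm_num), hone]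
      · simp [execBlock, Instr.exec, hN]
      · simpa [execBlock, Instr.exec, State.Lists] using hL.next hlt
  · rintro s' - ⟨l, ⟨hF, hl, hlM, N, mu, hN, hL⟩, hlt⟩
    simp only [Test.Holds, hl, hF.1 3 (by norm_num), hM] at hlt
    obtain rfl : l = M := by omega
    exact ⟨N, mu, hN, hL, hF.1, hF.2⟩

end RealRAM

/-! ### The program -/

namespace RealRAM

/-- Compute the number of variables `n₃ = n₁ + 2` and the degree `n₄`, which is `a` times the least
`k` with `n₀ < 2 ^ (b * k)`. -/
def setup (a b : ℕ) : Program :=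
  (Program.block [.setNat 2 1, .setNat 3 2, .addNat 3 1 3, .setNat 6 1, .setNat 4 0, .addNat 7 0 2,
    .setNat 8 (2 ^ b), .setNat 9 a]).seq <|
  .while (.natLt 6 7) (Program.block [.mulNat 6 6 8, .addNat 4 4 9])

/-- The logarithm is found by multiplying by 2^b until n is exceeded, so only natural number
arithmetic is needed. -/
theorem setup_ensures {s : State} {B a b n m : ℕ} (hb : 0 < b) (hs : s.BoundedBy B)
    (hn : s.natReg 0 = n) (hm : s.natReg 1 = m) (hnB : 2 ^ b * (n + 1) ≤ B) (hmB : m + 2 ≤ B)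
    (haB : a * (Nat.clog (2 ^ b) (n + 1) + 1) ≤ B) :
    (setup a b).Ensures B (4 * Nat.clog (2 ^ b) (n + 1) + 10) s (fun s' =>
      s'.natReg 0 = n ∧ s'.natReg 1 = m ∧ s'.natReg 2 = 1 ∧ s'.natReg 3 = m + 2 ∧
      s'.natReg 4 = a * Nat.clog (2 ^ b) (n + 1) ∧ s'.natArr = s.natArr ∧
      s'.realArr = s.realArr) := by
  have h1b : 1 < 2 ^ b := Nat.one_lt_two_pow hb.ne'
  have hn1 : n + 1 ≤ B := le_trans (Nat.le_mul_of_pos_left _ (by omega)) hnB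
  have h2b : 2 ^ b ≤ B := le_trans (Nat.le_mul_of_pos_right _ (by omega)) hnB
  have ha : a ≤ B := le_trans (Nat.le_mul_of_pos_right _ (by omega)) haB
  let F : State → Prop := fun s' => s'.natReg 0 = n ∧ s'.natReg 1 = m ∧ s'.natReg 2 = 1 ∧
    s'.natReg 3 = m + 2 ∧ s'.natReg 7 = n + 1 ∧ s'.natReg 8 = 2 ^ b ∧ s'.natReg 9 = a ∧
    s'.natArr = s.natArr ∧ s'.realArr = s.realArr
  let I : ℕ → State → Prop := fun k s' =>
    F s' ∧ k ≤ Nat.clog (2 ^ b) (n + 1) ∧ s'.natReg 6 = (2 ^ b) ^ k ∧ s'.natReg 4 = a * k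
  refine Program.Ensures.mono (k := (8 + 1) + (Nat.clog (2 ^ b) (n + 1) * ((2 + 1) + 1) + 1))
    (.seq (R := I 0) (.block hs ?_ ?_) fun s₁ hs₁ h₁ => .loop I _ hs₁ h₁ ?_) (by omega) ?_
  · simp [FitsBlock, Instr.Fits, Instr.exec, hn, hm]
    omega
  · simp [I, F, execBlock, Instr.exec, hn, hm]
  · rintro k t ht ⟨⟨h0, h1, h2, h3, h7, h8, h9, hN, hR⟩, -, h6, h4⟩ hlt
    simp only [Test.Holds, h6, h7] at hlt
    have hk := (Nat.lt_clog_iff_pow_lt h1b).2 hlt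
    refine ⟨hk, .block ht ?_ ?_⟩
    -- The test bounds the power before the multiplication by n + 1, hence the factor 2^b in the
    -- memory bound.
    · have h5 : (2 ^ b) ^ k * 2 ^ b ≤ B := by
        refine le_trans ?_ hnB
        rw [mul_comm]
        exact Nat.mul_le_mul_left _ hlt.le
      have h5' : a * k + a ≤ B := le_trans (Nat.mul_le_mul_left a (by omega : k + 1 ≤ _)) haB
      simp [FitsBlock, Instr.Fits, Instr.exec, h6, h8, h4, h9, h5, h5']
    · refine ⟨?_, hk, ?_, ?_⟩
      · simp [F, execBlock, Instr.exec, *]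
      · simp [execBlock, Instr.exec, h6, h8, pow_succ]
      · simp [execBlock, Instr.exec, h4, h9, mul_add]
  · rintro s' - ⟨k, ⟨⟨h0, h1, h2, h3, h7, h8, h9, hN, hR⟩, hk, h6, h4⟩, hlt⟩
    simp only [Test.Holds, h6, h7, not_lt] at hlt
    obtain rfl : k = Nat.clog (2 ^ b) (n + 1) := le_antisymm hk (Nat.clog_le_of_le_pow hlt)
    exact ⟨h0, h1, h2, h3, h4, hN, hR⟩

/-- The program for batch Gaussian kernel density estimation: replace `exp (-‖x - y‖²)` by its
Taylor polynomial, and expand the polynomial into monomials in the coordinates of `x` and `y`. -/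
def gaussianKDE (a b : ℕ) : Program :=
  (setup a b).seq <| enumerate.seq <|
    (computeMoments 2 (-1) 0 0 (-1)).seq <| computePotentials 1 0 1 1 0

/-- Multinomial theorem in each degree k; division by k! turns the multinomial coefficient into the
inverse product of factorials. -/
theorem sum_multiIndices (M q : ℕ) (x y : ℕ → ℝ) :
    ∑ μ ∈ multiIndices M q, monomialAt M x μ * monomialAt M y μ *
      (∏ i ∈ Finset.range M, ((μ i).factorial : ℝ))⁻¹ =
    ∑ k ∈ Finset.range (q + 1), (∑ l ∈ Finset.range M, x l * y l) ^ k / k.factorial := by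
  classical
  unfold multiIndices
  rw [Finset.sum_biUnion]
  · refine Finset.sum_congr rfl fun k _ => ?_
    rw [Finset.sum_pow_eq_sum_piAntidiag, Finset.sum_div]
    refine Finset.sum_congr rfl fun μ hμ => ?_
    have hk : ∑ i ∈ Finset.range M, μ i = k := (Finset.mem_piAntidiag.1 hμ).1
    have hmul : (∏ i ∈ Finset.range M, ((μ i).factorial : ℝ)) *
        Nat.multinomial (Finset.range M) μ = k.factorial := by
      rw [← hk]
      exact_mod_cast Nat.multinomial_spec (Finset.range M) μ
    have hpos : (∏ i ∈ Finset.range M, ((μ i).factorial : ℝ)) ≠ 0 :=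
      Finset.prod_ne_zero_iff.2 fun i _ => by positivity
    rw [← hmul, monomialAt, monomialAt, ← Finset.prod_mul_distrib]
    simp_rw [← mul_pow]
    have : (Nat.multinomial (Finset.range M) μ : ℝ) ≠ 0 := by
      exact_mod_cast (Nat.multinomial_pos _ _).ne'
    field_simp
  · intro k _ k' _ hkk'
    refine Finset.disjoint_left.2 fun μ h h' => hkk' ?_
    rw [Finset.mem_piAntidiag] at h h'
    exact h.1.symm.trans h'.1

/-- The lifts are (x, ‖x‖², 1) and (2y, -1, -‖y‖²). -/
theorem sum_liftPoint_mul_liftPoint (m : ℕ) (x y : ℕ → ℝ) :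
    ∑ l ∈ Finset.range (m + 2), liftPoint m 1 0 1 1 0 x l * liftPoint m 2 (-1) 0 0 (-1) y l =
      -∑ l ∈ Finset.range m, (x l - y l) ^ 2 := by
  rw [Finset.sum_range_succ, Finset.sum_range_succ]
  have : ∀ l ∈ Finset.range m, liftPoint m 1 0 1 1 0 x l * liftPoint m 2 (-1) 0 0 (-1) y l =
      x l ^ 2 + y l ^ 2 - (x l - y l) ^ 2 := by
    intro l hl
    simp only [liftPoint, Finset.mem_range.1 hl, if_true]
    ring
  rw [Finset.sum_congr rfl this, Finset.sum_sub_distrib, Finset.sum_add_distrib]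
  simp [liftPoint]
  ring

end RealRAM

/-! ### Exact output and step count of the whole program -/

namespace BatchKDE

open RealRAM

theorem flatten_apply {n m : ℕ} (x : Fin n → EuclideanSpace ℝ (Fin m)) (i : Fin n) (l : Fin m) :
    flatten x (i * m + l) = x i l := by
  have hm : 0 < m := l.pos
  have h1 : (i * m + l : ℕ) / m = i := by
    rw [mul_comm, Nat.mul_add_div hm, Nat.div_eq_of_lt l.2, add_zero]
  have h2 : (i * m + l : ℕ) % m = l := by
    rw [mul_comm, Nat.mul_add_mod, Nat.mod_eq_of_lt l.2]
  simp [flatten, h1, h2]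

theorem sum_flatten_sub_sq {n m : ℕ} (x y : Fin n → EuclideanSpace ℝ (Fin m)) (i j : Fin n) :
    ∑ l ∈ Finset.range m, (flatten x (i * m + l) - flatten y (j * m + l)) ^ 2 =
      ‖x i - y j‖ ^ 2 := by
  rw [EuclideanSpace.norm_sq_eq, Finset.sum_range]
  simp [flatten_apply]

/-- Arithmetic is exact, so the output equals the Taylor sum for arbitrary points; the distance
bound enters only in the error analysis. -/
theorem gaussianKDE_ensures {n m a b D B : ℕ} (hb : 0 < b)
    (hD : (m + 2 + a * Nat.clog (2 ^ b) (n + 1)).choose (a * Nat.clog (2 ^ b) (n + 1)) ≤ D)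
    (hB : 2 ^ b * (n + 1) + a * (Nat.clog (2 ^ b) (n + 1) + 1) + n * m + n + m + 2 + D ≤ B)
    (x y : Fin n → EuclideanSpace ℝ (Fin m)) (w : Fin n → ℝ) (δ : ℝ) :
    (gaussianKDE a b).Ensures B (4 * Nat.clog (2 ^ b) (n + 1) + (m + 2) * (23 * D + 6) +
      n * (18 * m + 35 * D + 61) + 24) (input x y w δ) (fun s => ∀ i, output n s i =
        ∑ j, w j * ∑ k ∈ Finset.range (a * Nat.clog (2 ^ b) (n + 1) + 1),
          (-‖x i - y j‖ ^ 2) ^ k / k.factorial) := by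
  set q := a * Nat.clog (2 ^ b) (n + 1) with hq
  have hin : (input x y w δ).BoundedBy B := by
    refine ⟨fun i => ?_, fun _ _ => Nat.zero_le _⟩
    simp only [input]
    split_ifs <;> omega
  have haq : q ≤ a * (Nat.clog (2 ^ b) (n + 1) + 1) := by rw [hq]; gcongr; omega
  refine Program.Ensures.mono
    (.seq (setup_ensures (a := a) (n := n) (m := m) hb hin rfl rfl (by omega) (by omega) (by omega))
      fun s₁ hs₁ h₁ => .seq (enumerate_ensures (M := m + 2) (q := q) (D := D) hs₁ h₁.2.2.1
        h₁.2.2.2.1 h₁.2.2.2.2.1 ?_ ?_ ?_ (by omega) (by omega) (by omega) (by omega))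
        fun s₂ hs₂ h₂ => (?_ : Program.Ensures B _ (n * (18 * m + 35 * D + 61) + 8) s₂
          (fun s => ∀ i, output n s i = ∑ j, w j * ∑ k ∈ Finset.range (q + 1),
            (-‖x i - y j‖ ^ 2) ^ k / k.factorial))) (by omega) fun _ _ h => h
  · intro c p
    rw [h₁.2.2.2.2.2.1]; rfl
  · intro p
    rw [h₁.2.2.2.2.2.2]; simp [input]
  · exact (card_multiIndices_le _ _).trans hD
  obtain ⟨h10, h11, h12, h13, h14, h1N, h1R⟩ := h₁
  obtain ⟨N, mu, hN, hL, h2n, h2R⟩ := h₂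
  have hND : N ≤ D := hL.card_le.trans ((card_multiIndices_le _ _).trans hD)
  have hnat {i : ℕ} (hi : i < 5) : s₂.natReg i = s₁.natReg i := h2n i hi
  have harr (c : ℕ) (h4 : c ≠ 4) (h8 : c ≠ 8) : s₂.realArr c = (input x y w δ).realArr c := by
    rw [h2R c h4 h8, h1R]
  refine Program.Ensures.mono
    (.seq (computeMoments_ensures (n := n) (m := m) (N := N) (mu := mu)
        (p := fun j l => flatten y (j * m + l)) 2 (-1) 0 0 (-1) hs₂
        ((hnat (by norm_num)).trans h10) ((hnat (by norm_num)).trans h11)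
        ((hnat (by norm_num)).trans h12) hN hL.tree ?_ ?_ (by omega) (by omega))
      fun s₃ hs₃ ⟨h3N, h3R, h3n, h37⟩ =>
        .mono (computePotentials_ensures (n := n) (m := m) (N := N) (mu := mu)
        (p := fun j l => flatten x (j * m + l)) 1 0 1 1 0 hs₃
        ((h3n 0 (by norm_num)).trans ((hnat (by norm_num)).trans h10))
        ((h3n 1 (by norm_num)).trans ((hnat (by norm_num)).trans h11))
        ((h3n 2 (by norm_num)).trans ((hnat (by norm_num)).trans h12))
        ((h3n 5 (by norm_num)).trans hN) (by rw [h3N]; exact hL.tree) ?_ (by omega) (by omega))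
        le_rfl (Q := fun s => ∀ i, output n s i = ∑ j, w j * ∑ k ∈ Finset.range (q + 1),
            (-‖x i - y j‖ ^ 2) ^ k / k.factorial) ?_)
      ?_ fun _ _ h => h
  · intro j _ l _
    rw [harr 1 (by norm_num) (by norm_num)]; rfl
  · intro e _
    rw [harr 7 (by norm_num) (by norm_num)]; simp [input]
  · intro j _ l _
    rw [h3R 0 (by norm_num) (by norm_num) (by norm_num), harr 0 (by norm_num) (by norm_num)]; rfl
  · intro s₄ _ h i
    have h2 (j : Fin n) : s₂.realArr 2 j = w j := by
      rw [harr 2 (by norm_num) (by norm_num)]; simp [input]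
    rw [output, h i i.2]
    set X := liftPoint m 1 0 1 1 0 fun l => flatten x (i * m + l) with hX
    set Y : ℕ → ℕ → ℝ := fun j => liftPoint m 2 (-1) 0 0 (-1) fun l => flatten y (j * m + l) with hY
    have hterm : ∀ e ∈ Finset.range N, monomialAt (m + 2) (liftPoint m ((1 : ℚ) : ℝ) ((0 : ℚ) : ℝ)
        ((1 : ℚ) : ℝ) ((1 : ℚ) : ℝ) ((0 : ℚ) : ℝ) fun l => flatten x (i * m + l)) (mu e) *
        s₃.realArr 7 e * s₃.realArr 8 e = ∑ j : Fin n, w j * (monomialAt (m + 2) X (mu e) *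
          monomialAt (m + 2) (Y j) (mu e) *
            (∏ i ∈ Finset.range (m + 2), ((mu e i).factorial : ℝ))⁻¹) := by
      intro e he
      rw [Finset.mem_range] at he
      rw [h37 e he, h3R 8 (by norm_num) (by norm_num) (by norm_num), hL.fac_eq e he,
        Finset.sum_range, Finset.mul_sum, Finset.sum_mul]
      refine Finset.sum_congr rfl fun j _ => ?_
      rw [h2 j]
      push_cast
      ring
    -- Exchanging monomials and sources undoes the factorization and leaves the polynomial kernel
    -- for each source.
    rw [Finset.sum_congr rfl hterm, Finset.sum_comm]
    refine Finset.sum_congr rfl fun j _ => ?_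
    rw [← Finset.mul_sum, hL.sum_eq fun μ => monomialAt (m + 2) X μ * monomialAt (m + 2) (Y j) μ *
      (∏ i ∈ Finset.range (m + 2), ((μ i).factorial : ℝ))⁻¹, sum_multiIndices, hX, hY,
      sum_liftPoint_mul_liftPoint, sum_flatten_sub_sq]
  · have : N * n ≤ D * n := Nat.mul_le_mul_right n hND
    nlinarith

end BatchKDE

/-! ### Taylor approximation of the kernel -/

namespace BatchKDE

open RealRAM

/-- Write t^k = ρ^k (t/ρ)^k and use ρ^k ≤ ρ^Q for k ≥ Q; the remaining series is at most that of
exp(t/ρ). -/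
theorem exp_sub_sum_le {ρ t : ℝ} (hρ : 0 < ρ) (hρ1 : ρ ≤ 1) (ht : 0 ≤ t) (Q : ℕ) :
    Real.exp t - ∑ k ∈ Finset.range Q, t ^ k / k.factorial ≤ ρ ^ Q * Real.exp (t / ρ) := by
  have hexp (u : ℝ) : HasSum (fun k : ℕ => u ^ k / k.factorial) (Real.exp u) := by
    rw [Real.exp_eq_exp_ℝ]
    exact NormedSpace.expSeries_div_hasSum_exp u
  have h1 := ((hasSum_nat_add_iff' Q).2 (hexp t))
  have h2 := ((hexp (t / ρ)).mul_left (ρ ^ Q))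
  have h3 := (hasSum_nat_add_iff' Q).2 h2
  have h4 : ∀ k : ℕ, t ^ (k + Q) / (k + Q).factorial ≤
      ρ ^ Q * ((t / ρ) ^ (k + Q) / (k + Q).factorial) := by
    intro k
    rw [← mul_div_assoc]
    gcongr
    rw [div_pow, pow_add ρ, mul_comm (ρ ^ k), ← mul_div_assoc,
      mul_div_mul_left _ _ (pow_pos hρ Q).ne']
    exact le_div_self (by positivity) (by positivity) (pow_le_one₀ hρ.le hρ1)
  refine (hasSum_le h4 h1 h3).trans (sub_le_self _ (Finset.sum_nonneg fun k _ => ?_))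
  positivity

/-- The remainder at -t is at most the remainder at t in absolute value, as the triangle inequality
on the tail shows. -/
theorem abs_exp_neg_sub_sum_le {ρ t : ℝ} (hρ : 0 < ρ) (hρ1 : ρ ≤ 1) (ht : 0 ≤ t) (Q : ℕ) :
    |Real.exp (-t) - ∑ k ∈ Finset.range Q, (-t) ^ k / k.factorial| ≤
      ρ ^ Q * Real.exp (t / ρ) := by
  have := Complex.norm_exp_sub_sum_le_exp_norm_sub_sum (-t : ℝ) Q
  rw [Complex.norm_real, Real.norm_eq_abs, abs_neg, abs_of_nonneg ht] at this
  have h : Complex.exp ((-t : ℝ) : ℂ) - ∑ k ∈ Finset.range Q, ((-t : ℝ) : ℂ) ^ k / k.factorial =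
      ((Real.exp (-t) - ∑ k ∈ Finset.range Q, (-t) ^ k / k.factorial : ℝ) : ℂ) := by
    push_cast
    rfl
  rw [h, Complex.norm_real, Real.norm_eq_abs] at this
  exact this.trans (exp_sub_sum_le hρ hρ1 ht Q)

/-- A Taylor polynomial of degree at least `γ log n` is precise enough. -/
theorem abs_exp_neg_sub_sum_le_rpow {β κ γ t : ℝ} {n q : ℕ} (hn : 1 ≤ n) (hκ : 0 < κ) (hγ : 0 < γ)
    (h1 : 1 ≤ Real.log γ + Real.log κ⁻¹) (hβ : β ≤ γ * (Real.log γ + Real.log κ⁻¹ - 1))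
    (hq : γ * Real.log n ≤ q) (ht : 0 ≤ t) (htn : t ≤ κ * Real.log n) :
    |Real.exp (-t) - ∑ k ∈ Finset.range (q + 1), (-t) ^ k / k.factorial| ≤ (n : ℝ) ^ (-β) := by
  have hn' : (1 : ℝ) ≤ n := by exact_mod_cast hn
  have hlog : 0 ≤ Real.log n := Real.log_nonneg hn'
  -- The choice ρ = κ/γ minimizes ρ^Q exp(t/ρ) at the extreme values Q = γ log n, t = κ log n.
  have hρ : 0 < κ / γ := by positivity
  have hlogρ : Real.log (κ / γ) = -(Real.log γ + Real.log κ⁻¹) := by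
    rw [Real.log_div hκ.ne' hγ.ne', Real.log_inv]; ring
  have hρ1 : κ / γ ≤ 1 := by
    rw [← Real.log_nonpos_iff hρ.le, hlogρ]; linarith
  refine (abs_exp_neg_sub_sum_le hρ hρ1 ht (q + 1)).trans ?_
  have h2 : t / (κ / γ) ≤ γ * Real.log n := by
    rw [div_le_iff₀ hρ]
    have : γ * Real.log n * (κ / γ) = κ * Real.log n := by field_simp
    linarith
  rw [Real.rpow_def_of_pos (by linarith), ← Real.rpow_natCast (κ / γ), Real.rpow_def_of_pos hρ,
    ← Real.exp_add, Real.exp_le_exp, hlogρ]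
  push_cast
  nlinarith [mul_le_mul_of_nonneg_left hβ hlog]

theorem isSolution_of_forall {n m : ℕ} {x y : Fin n → EuclideanSpace ℝ (Fin m)} {w v : Fin n → ℝ}
    {δ : ℝ} (hδ : 0 ≤ δ) (P : Fin n → Fin n → ℝ) (hv : ∀ i, v i = ∑ j, w j * P i j)
    (hP : ∀ i j, |Real.exp (-‖x i - y j‖ ^ 2) - P i j| ≤ δ) : IsSolution x y w δ v := by
  have hw : 0 ≤ ∑ j, |w j| := Finset.sum_nonneg fun j _ => abs_nonneg _
  refine (pi_norm_le_iff_of_nonneg (mul_nonneg hδ hw)).2 fun i => ?_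
  have : ((kernelMatrix x y).mulVec w - v) i =
      ∑ j, (Real.exp (-‖x i - y j‖ ^ 2) - P i j) * w j := by
    simp only [Pi.sub_apply, Matrix.mulVec, dotProduct, kernelMatrix, Matrix.of_apply, hv i,
      ← Finset.sum_sub_distrib]
    exact Finset.sum_congr rfl fun j _ => by ring
  rw [this, Real.norm_eq_abs, Finset.mul_sum]
  refine (Finset.abs_sum_le_sum_abs _ _).trans (Finset.sum_le_sum fun j _ => ?_)
  rw [abs_mul]
  exact mul_le_mul_of_nonneg_right (hP i j) (abs_nonneg _)

/-! ### The size of the parameters -/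

/-- This is a single term of the binomial expansion of (z + (1 - z))^(M + q) = 1. -/
theorem choose_add_mul_le_one {z : ℝ} (hz : 0 ≤ z) (hz1 : z ≤ 1) (M q : ℕ) :
    ((M + q).choose q : ℝ) * (z ^ q * (1 - z) ^ M) ≤ 1 := by
  have h := add_pow z (1 - z) (M + q)
  rw [add_sub_cancel, one_pow] at h
  refine le_trans ?_ h.ge
  refine le_trans (le_of_eq ?_) (Finset.single_le_sum (f := fun k => z ^ k *
    (1 - z) ^ (M + q - k) * ((M + q).choose k : ℝ)) (fun k _ => ?_)
    (Finset.mem_range.2 (by omega : q < M + q + 1)))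
  · simp only [Nat.add_sub_cancel]; ring
  · have : 0 ≤ 1 - z := by linarith
    positivity

theorem choose_add_le_exp {L : ℝ} (hL : 0 < L) (M q : ℕ) :
    ((M + q).choose q : ℝ) ≤ Real.exp (q * Real.log (2 * (1 + L)) + M / (1 + L)) := by
  have hL' : 0 < 1 + L := by linarith
  -- With this z each unit of degree costs log(2(1 + L)) in the exponent, while each dimension costs
  -- only 1/(1 + L).
  set z : ℝ := (2 * (1 + L))⁻¹ with hz
  have hz0 : 0 < z := by positivity
  have hz2 : z ≤ 1 / 2 := by
    rw [hz, one_div]; exact inv_anti₀ (by norm_num) (by linarith)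
  have h := choose_add_mul_le_one hz0.le (by linarith) M q
  have h1 : Real.exp (q * Real.log (2 * (1 + L))) = (z ^ q)⁻¹ := by
    rw [mul_comm, ← Real.rpow_def_of_pos (by positivity), Real.rpow_natCast, hz, inv_pow, inv_inv]
  have h2 : ((1 - z) ^ M)⁻¹ ≤ Real.exp (M / (1 + L)) := by
    have h3 : (1 - z)⁻¹ ≤ Real.exp (2 * z) := by
      have := Real.add_one_le_exp (2 * z)
      rw [inv_le_iff_one_le_mul₀ (by linarith)]
      nlinarith
    have h4 : (M : ℝ) / (1 + L) = M * (2 * z) := by rw [hz]; field_simp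
    rw [h4, Real.exp_nat_mul, ← inv_pow]
    exact pow_le_pow_left₀ (inv_nonneg.2 (by linarith)) h3 M
  have hzz : 0 < z ^ q * (1 - z) ^ M := mul_pos (pow_pos hz0 q) (pow_pos (by linarith) M)
  calc ((M + q).choose q : ℝ) ≤ (z ^ q * (1 - z) ^ M)⁻¹ := by
        rw [← one_div, le_div_iff₀ hzz]; exact h
    _ = (z ^ q)⁻¹ * ((1 - z) ^ M)⁻¹ := mul_inv _ _
    _ ≤ _ := by
        rw [Real.exp_add, h1]
        exact mul_le_mul_of_nonneg_left h2 (inv_nonneg.2 (pow_pos hz0 q).le)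

theorem log_le_mul_clog {b n : ℕ} (hb : 0 < b) (hn : 1 ≤ n) :
    Real.log n ≤ b * Nat.clog (2 ^ b) (n + 1) := by
  have h1 : n ≤ 2 ^ (b * Nat.clog (2 ^ b) (n + 1)) := by
    rw [pow_mul]
    exact (Nat.le_succ n).trans (Nat.le_pow_clog (Nat.one_lt_two_pow hb.ne') (n + 1))
  have h2 : (n : ℝ) ≤ 2 ^ (b * Nat.clog (2 ^ b) (n + 1)) := by exact_mod_cast h1
  have h3 := Real.log_le_log (by exact_mod_cast hn) h2
  rw [Real.log_pow] at h3
  refine h3.trans ?_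
  have := Real.log_two_lt_d9
  push_cast
  have h0 : (0 : ℝ) ≤ b * Nat.clog (2 ^ b) (n + 1) := by positivity
  nlinarith

/-- The factor 2 bounds 1 / log 2, and the summand b is the overshoot of the last multiplication. -/
theorem mul_clog_le {b n : ℕ} (hb : 0 < b) (hn : 1 ≤ n) :
    (b : ℝ) * Nat.clog (2 ^ b) (n + 1) ≤ 2 * Real.log n + b := by
  have h1b := Nat.one_lt_two_pow hb.ne'
  obtain ⟨k, hk⟩ := Nat.exists_eq_succ_of_ne_zero (Nat.clog_pos h1b (by omega : 1 < n + 1)).ne'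
  have h1 := Nat.pow_pred_clog_lt_self h1b (by omega : 1 < n + 1)
  rw [hk, Nat.pred_succ, ← pow_mul, Nat.lt_succ_iff] at h1
  have h2 : (2 : ℝ) ^ (b * k) ≤ n := by exact_mod_cast h1
  have h3 := Real.log_le_log (by positivity) h2
  rw [Real.log_pow] at h3
  have := Real.log_two_gt_d9
  rw [hk]
  push_cast at h3 ⊢
  have h0 : (0 : ℝ) ≤ b * k := by positivity
  nlinarith

/-- The bit length is k + 1 with 2^k ≤ x, and k ≤ 2 log x ≤ 2 x^ε / ε. Thus bit costs are absorbed
by any positive power. -/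
theorem size_le_rpow {ε : ℝ} (hε : 0 < ε) {x : ℕ} (hx : 1 ≤ x) :
    (1 + 2 * Nat.size x : ℝ) ≤ (3 + 4 / ε) * (x : ℝ) ^ ε := by
  have hx' : (1 : ℝ) ≤ x := by exact_mod_cast hx
  obtain ⟨k, hk⟩ := Nat.exists_eq_succ_of_ne_zero (Nat.size_pos.2 hx).ne'
  have h1 : 2 ^ k ≤ x := Nat.lt_size.1 (by omega)
  have h2 : (2 : ℝ) ^ k ≤ x := by exact_mod_cast h1
  have h3 := Real.log_le_log (by positivity) h2
  rw [Real.log_pow] at h3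
  have h4 := Real.log_le_rpow_div (by linarith : (0 : ℝ) ≤ x) hε
  have h5 := Real.one_le_rpow hx' hε.le
  have := Real.log_two_gt_d9
  have h6 : (k : ℝ) ≤ 2 * ((x : ℝ) ^ ε / ε) := by
    have : (0 : ℝ) ≤ k := by positivity
    nlinarith
  rw [hk]
  push_cast
  have h7 : 4 / ε * (x : ℝ) ^ ε = 4 * ((x : ℝ) ^ ε / ε) := by ring
  rw [add_mul, h7]
  linarith

end BatchKDE

/-! ### The running time -/

namespace BatchKDE

open RealRAM

/-- The number of elementary steps is at most `n ^ (1 + E + η)`, up to a constant factor. -/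
theorem exists_workload_le {α L E η : ℝ} {a b : ℕ} (hα : 0 < α) (hL : 0 < L) (hη : 0 < η)
    (hb : 0 < b) (hLb : L ≤ b)
    (hE : 2 * a * Real.log (2 * (1 + L)) / L + α / (1 + L) ≤ E) :
    ∃ C : ℝ, 0 < C ∧ ∀ n : ℕ, 1 ≤ n →
      (n : ℝ) * ((⌈α * Real.log n⌉₊ + 2 + a * Nat.clog (2 ^ b) (n + 1)).choose
        (a * Nat.clog (2 ^ b) (n + 1)) : ℝ) *
        (⌈α * Real.log n⌉₊ + Nat.clog (2 ^ b) (n + 1) + 1 : ℝ) ≤ C * (n : ℝ) ^ (1 + E + η) := by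
  set S := Real.log (2 * (1 + L)) with hS
  have hS0 : 0 ≤ S := Real.log_nonneg (by linarith)
  -- The first factor collects the rounding terms: one additional unit of K, and 3 dimensions from
  -- the ceiling and the two lifted coordinates. The second one bounds the logarithmic factor by
  -- n^η.
  refine ⟨Real.exp (a * S + 3 / (1 + L)) * ((α + 2) / η + 3), by positivity, fun n hn => ?_⟩
  have hn' : (1 : ℝ) ≤ n := by exact_mod_cast hn
  have hn0 : (0 : ℝ) < n := by linarith
  set l := Real.log n with hl
  have hl0 : 0 ≤ l := Real.log_nonneg hn'
  set K := Nat.clog (2 ^ b) (n + 1) with hK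
  have hM : (⌈α * l⌉₊ : ℝ) ≤ α * l + 1 := (Nat.ceil_lt_add_one (by positivity)).le
  have hbK := mul_clog_le hb hn
  rw [← hK, ← hl] at hbK
  have hb' : (1 : ℝ) ≤ b := by exact_mod_cast hb
  have hb0 : (0 : ℝ) < b := by linarith
  have hKb : (K : ℝ) ≤ 2 * l / b + 1 := by
    rw [← sub_le_iff_le_add, le_div_iff₀ hb0]
    linarith
  have hKl : (K : ℝ) ≤ 2 * l / L + 1 := by
    refine hKb.trans ?_
    gcongr
  have hK1 : (K : ℝ) ≤ 2 * l + 1 := by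
    refine hKb.trans ?_
    gcongr
    exact div_le_self (by positivity) hb'
  have hD : ((⌈α * l⌉₊ + 2 + a * K).choose (a * K) : ℝ) ≤
      Real.exp (a * S + 3 / (1 + L)) * (n : ℝ) ^ E := by
    refine (choose_add_le_exp hL _ _).trans ?_
    rw [Real.rpow_def_of_pos hn0, ← Real.exp_add, Real.exp_le_exp, ← hl, ← hS]
    push_cast
    have h1 : (a * K : ℝ) * S ≤ a * (2 * l / L + 1) * S := by gcongr
    have h2 : (⌈α * l⌉₊ + 2 : ℝ) / (1 + L) ≤ (α * l + 3) / (1 + L) :=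
      div_le_div_of_nonneg_right (by linarith) (by linarith)
    have h3 := mul_le_mul_of_nonneg_left hE hl0
    have h4 : a * (2 * l / L + 1) * S + (α * l + 3) / (1 + L) =
        l * (2 * a * S / L + α / (1 + L)) + (a * S + 3 / (1 + L)) := by ring
    linarith
  have hR : (⌈α * l⌉₊ + K + 1 : ℝ) ≤ ((α + 2) / η + 3) * (n : ℝ) ^ η := by
    have h1 := Real.log_le_rpow_div hn0.le hη
    have h2 := Real.one_le_rpow hn' hη.le
    rw [← hl] at h1
    calc (⌈α * l⌉₊ + K + 1 : ℝ) ≤ (α + 2) * l + 3 := by linarith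
      _ ≤ (α + 2) * ((n : ℝ) ^ η / η) + 3 * (n : ℝ) ^ η := by gcongr; linarith
      _ = _ := by ring
  calc _ ≤ (n : ℝ) * (Real.exp (a * S + 3 / (1 + L)) * (n : ℝ) ^ E) *
        (((α + 2) / η + 3) * (n : ℝ) ^ η) := by gcongr
    _ = _ := by
        rw [Real.rpow_add hn0, Real.rpow_add hn0, Real.rpow_one]
        ring

theorem solvableInTime_of_params {α β κ E η : ℝ} {a b : ℕ} (hα : 0 < α) (hκ : 0 < κ) (hη : 0 < η)
    (hE0 : 0 ≤ E) (ha : 0 < a) (hL : 0 < Real.log κ⁻¹) (hLb : Real.log κ⁻¹ ≤ b)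
    (h1 : 1 ≤ Real.log (a / b : ℝ) + Real.log κ⁻¹)
    (hβ : β ≤ (a / b : ℝ) * (Real.log (a / b : ℝ) + Real.log κ⁻¹ - 1))
    (hE : 2 * a * Real.log (2 * (1 + Real.log κ⁻¹)) / Real.log κ⁻¹ +
      α / (1 + Real.log κ⁻¹) ≤ E) :
    SolvableInTime α β κ (fun n : ℕ => (n : ℝ) ^ (1 + E + η)) := by
  have hb0 : (0 : ℝ) < b := hL.trans_le hLb
  have hb : 0 < b := by exact_mod_cast hb0
  have ha0 : (0 : ℝ) < a := by exact_mod_cast ha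
  -- Half of η is spent on the logarithmic factor in the number of steps, the other half on the bit
  -- lengths.
  obtain ⟨C, hC, hW⟩ := exists_workload_le (η := η / 2) hα hL (by positivity) hb hLb hE
  let K : ℕ → ℕ := fun n => Nat.clog (2 ^ b) (n + 1)
  let M : ℕ → ℕ := fun n => ⌈α * Real.log n⌉₊
  let D : ℕ → ℕ := fun n => (M n + 2 + a * K n).choose (a * K n)
  let W : ℕ → ℕ := fun n => n * D n * (M n + K n + 1)
  -- A is chosen so that `A * W n` bounds every natural number in memory.
  let A : ℕ := 2 * 2 ^ b + 2 * a + 10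
  let T : ℕ → ℕ := fun n => 300 * W n * (1 + 2 * Nat.size (A * W n))
  have hDpos (n : ℕ) : 1 ≤ D n := Nat.choose_pos (Nat.le_add_left _ _)
  have hWpos {n : ℕ} (hn : 1 ≤ n) : 1 ≤ W n :=
    Nat.mul_pos (Nat.mul_pos hn (hDpos n)) (Nat.succ_pos _)
  refine ⟨gaussianKDE a b, T, ?_, ?_⟩
  · set e := 1 + E + η / 2 with he
    set ε := (η / 2) / e with hε
    have he0 : 0 < e := by positivity
    have hε0 : 0 < ε := by positivity
    have heε : e + e * ε = 1 + E + η := by rw [hε, mul_div_cancel₀ _ he0.ne', he]; ring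
    refine Asymptotics.IsBigO.of_bound (300 * C * ((3 + 4 / ε) * (A * C) ^ ε))
      (Filter.eventually_atTop.2 ⟨1, fun n hn => ?_⟩)
    have hn' : (1 : ℝ) ≤ n := by exact_mod_cast hn
    have hn0 : (0 : ℝ) ≤ n := by linarith
    have hWn : (W n : ℝ) ≤ C * (n : ℝ) ^ e := by
      have := hW n hn
      simp only [W, D, M, K]
      push_cast
      exact this
    have hs := size_le_rpow hε0 (Nat.mul_pos (by omega : 0 < A) (hWpos hn))
    have hs' : ((A * W n : ℕ) : ℝ) ^ ε ≤ (A * C) ^ ε * (n : ℝ) ^ (e * ε) := by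
      rw [Real.rpow_mul hn0, ← Real.mul_rpow (by positivity) (by positivity)]
      refine Real.rpow_le_rpow (by positivity) ?_ hε0.le
      push_cast
      rw [mul_assoc]
      gcongr
    rw [Real.norm_of_nonneg (by positivity), Real.norm_of_nonneg (by positivity), ← heε,
      Real.rpow_add (by linarith)]
    calc (T n : ℝ) = 300 * W n * (1 + 2 * Nat.size (A * W n)) := by simp only [T]; push_cast; rfl
      _ ≤ 300 * (C * (n : ℝ) ^ e) * ((3 + 4 / ε) * ((A * C) ^ ε * (n : ℝ) ^ (e * ε))) := by
          gcongr
          exact hs.trans (by gcongr)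
      _ = _ := by ring
  · intro n m hn hm x y w hxy
    have hDn := hDpos n
    have hmono : (m + 2 + a * K n).choose (a * K n) ≤ D n :=
      Nat.choose_le_choose _ (by simp only [M]; omega)
    have hmM : m ≤ M n := hm
    have hWn : W n = n * D n * M n + n * D n * K n + n * D n := by simp only [W]; ring
    have hnd : n ≤ n * D n := Nat.le_mul_of_pos_right _ hDn
    have hdn : D n ≤ n * D n := Nat.le_mul_of_pos_left _ hn
    have hkW : K n ≤ n * D n * K n := Nat.le_mul_of_pos_left _ (hn.trans hnd)
    have hmW : m ≤ n * D n * M n := hmM.trans (Nat.le_mul_of_pos_left _ (hn.trans hnd))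
    have hnm : n * m ≤ n * D n * M n := Nat.mul_le_mul hnd hmM
    have hdm : D n * m ≤ n * D n * M n := Nat.mul_le_mul hdn hmM
    have hB : 2 ^ b * (n + 1) + a * (K n + 1) + n * m + n + m + 2 + D n ≤ A * W n := by
      have e1 : 2 ^ b * (n + 1) ≤ 2 ^ b * (2 * W n) := Nat.mul_le_mul_left _ (by omega)
      have e2 : a * (K n + 1) ≤ a * (2 * W n) := Nat.mul_le_mul_left _ (by omega)
      have e3 : A * W n = 2 ^ b * (2 * W n) + a * (2 * W n) + 10 * W n := by simp only [A]; ring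
      omega
    obtain ⟨t, s, hr, ht, -, hs⟩ := gaussianKDE_ensures hb hmono hB x y w ((n : ℝ) ^ (-β))
    refine ⟨t, s, hr, ht.trans (Nat.mul_le_mul_right _ ?_), ?_⟩
    · have e1 : 4 * K n + (m + 2) * (23 * D n + 6) + n * (18 * m + 35 * D n + 61) + 24 =
          4 * K n + 23 * (D n * m) + 6 * m + 46 * D n + 18 * (n * m) + 35 * (n * D n) + 61 * n +
            36 := by ring
      have e2 : 4 * K n + (m + 2) * (23 * D n + 6) + n * (18 * m + 35 * D n + 61) + 24 ≤
          300 * W n := by omega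
      exact e2
    · refine isSolution_of_forall (by positivity) _ hs fun i j =>
        abs_exp_neg_sub_sum_le_rpow hn hκ (div_pos ha0 hb0) h1 hβ ?_ (by positivity) (hxy i j)
      have := log_le_mul_clog hb hn
      push_cast
      rw [div_mul_eq_mul_div, div_le_iff₀ hb0, mul_assoc]
      refine mul_le_mul_of_nonneg_left ?_ ha0.le
      linarith

/-! ### Choice of the degree and the final exponents -/

theorem SolvableInTime.mono {α β κ : ℝ} {f g : ℕ → ℝ} (h : SolvableInTime α β κ f)
    (hfg : f =O[Filter.atTop] g) : SolvableInTime α β κ g := by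
  obtain ⟨prog, T, hT, hp⟩ := h
  exact ⟨prog, T, hT.trans hfg, hp⟩

theorem SolvableInTime.mono_rpow {α β κ e e' : ℝ}
    (h : SolvableInTime α β κ fun n : ℕ => (n : ℝ) ^ e) (he : e ≤ e') :
    SolvableInTime α β κ fun n : ℕ => (n : ℝ) ^ e' := by
  refine h.mono (Asymptotics.IsBigO.of_bound 1 (Filter.eventually_atTop.2 ⟨1, fun n hn => ?_⟩))
  have hn' : (1 : ℝ) ≤ n := by exact_mod_cast hn
  rw [one_mul, Real.norm_of_nonneg (by positivity), Real.norm_of_nonneg (by positivity)]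
  exact Real.rpow_le_rpow_of_exponent_le hn' he

/-- The ratio `a / b` meets the requirements of `abs_exp_neg_sub_sum_le_rpow`, if `a` is large and
`b` is `L` rounded up. -/
theorem degree_params {β L : ℝ} (hβ : 0 < β) (hL : Real.log 2 ≤ L) {a b : ℕ}
    (ha : 5 * β + 4 ≤ a) (hLb : L ≤ b) (hbL : b ≤ L + 1) :
    1 ≤ Real.log (a / b : ℝ) + L ∧ β ≤ (a / b : ℝ) * (Real.log (a / b : ℝ) + L - 1) := by
  have h2 := Real.log_two_gt_d9
  have h2' := Real.log_two_lt_d9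
  have hL0 : 0 < L := by linarith
  have hb0 : (0 : ℝ) < b := by linarith
  have ha0 : (0 : ℝ) < a := by linarith
  have hla : 2 * Real.log 2 ≤ Real.log a := by
    have : Real.log ((2 : ℝ) ^ 2) ≤ Real.log a := Real.log_le_log (by norm_num) (by linarith)
    rw [Real.log_pow] at this
    exact_mod_cast this
  -- Tangent line of the logarithm, applied to b/2: it makes log b cost only half of L. The summand
  -- 4 in the bound on a gives log a ≥ 2 log 2, which pays for the constants.
  have hlb : Real.log b ≤ Real.log 2 + (L + 1) / 2 - 1 := by
    have h3 := Real.log_le_sub_one_of_pos (by positivity : (0 : ℝ) < b / 2)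
    rw [Real.log_div hb0.ne' (by norm_num)] at h3
    linarith
  have h4 : L / 2 ≤ Real.log (a / b : ℝ) + L - 1 := by
    rw [Real.log_div ha0.ne' hb0.ne']
    linarith
  refine ⟨by linarith, ?_⟩
  -- The factor 5 comes from L + 1 ≤ 5L/2, valid because L ≥ log 2 > 2/3.
  have h5 : β ≤ (a / b : ℝ) * (L / 2) := by
    rw [div_mul_eq_mul_div, le_div_iff₀ hb0]
    have h6 : β * b ≤ β * (L + 1) := by gcongr
    have h7 : (5 * β) * (L / 2) ≤ a * (L / 2) := by gcongr; linarith
    nlinarith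
  exact h5.trans (by gcongr)

/-- For L ≥ log 2 > 2/3 one has 2(1 + L) ≤ 5L, and log 5 ≤ 2. -/
theorem log_two_mul_one_add_le {L : ℝ} (hL : Real.log 2 ≤ L) :
    Real.log (2 * (1 + L)) ≤ 3 * max 1 (Real.log L) := by
  have h2 := Real.log_two_gt_d9
  have hL0 : 0 < L := by linarith
  have he : (5 : ℝ) ≤ Real.exp 2 := by
    have h1 := Real.exp_one_gt_d9
    rw [show (2 : ℝ) = 1 + 1 by norm_num, Real.exp_add]
    nlinarith
  have h5 : Real.log 5 ≤ 2 := (Real.log_le_iff_le_exp (by norm_num)).2 he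
  have h6 : Real.log (2 * (1 + L)) ≤ Real.log (5 * L) :=
    Real.log_le_log (by linarith) (by linarith)
  rw [Real.log_mul (by norm_num) hL0.ne'] at h6
  linarith [le_max_left 1 (Real.log L), le_max_right 1 (Real.log L)]

theorem log_two_le_log_inv {κ : ℝ} (hκ : 0 < κ) (hκ2 : κ ≤ 1 / 2) : Real.log 2 ≤ Real.log κ⁻¹ :=
  Real.log_le_log (by norm_num) ((le_inv_comm₀ (by norm_num) hκ).2 (by linarith))

theorem exists_solvableInTime {α β : ℝ} (hα : 0 < α) (hβ : 0 < β) :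
    ∃ c : ℝ, 0 < c ∧ ∀ κ : ℝ, 0 < κ → κ < 1 / 2 → SolvableInTime α β κ (fun n : ℕ =>
      (n : ℝ) ^ (1 + c * max 1 (Real.log (Real.log κ⁻¹)) / Real.log κ⁻¹)) := by
  obtain ⟨a, ha⟩ := exists_nat_ge (5 * β + 4)
  -- Here 6a = 2a · 3 pays for the degree, α for the dimension, and 1 for the slack η = X/L.
  refine ⟨6 * a + α + 1, by positivity, fun κ hκ hκ2 => ?_⟩
  have hL := log_two_le_log_inv hκ hκ2.le
  set L := Real.log κ⁻¹ with hLdef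
  have h2 := Real.log_two_gt_d9
  have hL0 : 0 < L := by linarith
  have hLb : L ≤ ⌈L⌉₊ := Nat.le_ceil L
  obtain ⟨h1, h1'⟩ := degree_params hβ hL ha hLb (Nat.ceil_lt_add_one hL0.le).le
  set X := max 1 (Real.log L) with hX
  have hX1 : 1 ≤ X := le_max_left _ _
  have ha0 : 0 < a := by
    have : (0 : ℝ) < a := by linarith
    exact_mod_cast this
  have h3 := log_two_mul_one_add_le hL
  rw [← hX] at h3
  have hE : 2 * a * Real.log (2 * (1 + L)) / L + α / (1 + L) ≤ (6 * a + α) * X / L := by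
    have e1 : 2 * a * Real.log (2 * (1 + L)) / L ≤ 2 * a * (3 * X) / L := by gcongr
    have e2 : α / (1 + L) ≤ α * X / L :=
      div_le_div₀ (by positivity) (le_mul_of_one_le_right hα.le hX1) hL0 (by linarith)
    calc _ ≤ 2 * a * (3 * X) / L + α * X / L := add_le_add e1 e2
      _ = _ := by ring
  have := solvableInTime_of_params (β := β) (η := X / L) hα hκ (by positivity) (by positivity) ha0
    hL0 hLb h1 h1' hE
  refine this.mono_rpow (le_of_eq ?_)
  ring

end BatchKDE

theorem mainTheorem5 (α β : ℝ) (hα : 0 < α) (hβ : 0 < β) :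
    (∃ c : ℝ, 0 < c ∧ ∀ κ : ℝ, 0 < κ → κ < 1 / 2 →
      BatchKDE.SolvableInTime α β κ (fun n : ℕ =>
        (n : ℝ) ^ (1 + c * max 1 (Real.log (Real.log κ⁻¹)) / Real.log κ⁻¹))) ∧
    (∀ κ₀ : ℝ, 0 < κ₀ → κ₀ < Real.exp (-1) → ∃ c : ℝ, 0 < c ∧ ∀ κ : ℝ, 0 < κ → κ ≤ κ₀ →
      BatchKDE.SolvableInTime α β κ (fun n : ℕ =>
        (n : ℝ) ^ (1 + c * Real.log (Real.log κ⁻¹) / Real.log κ⁻¹))) := by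
  obtain ⟨c, hc, h⟩ := BatchKDE.exists_solvableInTime hα hβ
  refine ⟨⟨c, hc, h⟩, fun κ₀ hκ₀ hκ₀e => ?_⟩
  have hL₀ : 1 < Real.log κ₀⁻¹ := by
    have := Real.log_lt_log hκ₀ hκ₀e
    rw [Real.log_exp] at this
    rw [Real.log_inv]
    linarith
  have hLL₀ : 0 < Real.log (Real.log κ₀⁻¹) := Real.log_pos hL₀
  have he : Real.exp (-1) < 1 / 2 := by
    have := Real.exp_one_gt_d9
    rw [Real.exp_neg, one_div]
    exact inv_strictAnti₀ (by norm_num) (by linarith)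
  -- Multiplying by X lifts log log κ⁻¹ ≥ log log κ₀⁻¹ > 0 above 1 without decreasing it.
  set X := max 1 (Real.log (Real.log κ₀⁻¹))⁻¹ with hX
  refine ⟨c * X, by positivity, fun κ hκ hκκ₀ => (h κ hκ (by linarith)).mono_rpow ?_⟩
  have hL : Real.log κ₀⁻¹ ≤ Real.log κ⁻¹ :=
    Real.log_le_log (by positivity) (inv_anti₀ hκ hκκ₀)
  have hLL : Real.log (Real.log κ₀⁻¹) ≤ Real.log (Real.log κ⁻¹) :=
    Real.log_le_log (by linarith) hL
  have hmax : max 1 (Real.log (Real.log κ⁻¹)) ≤ X * Real.log (Real.log κ⁻¹) := by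
    refine max_le ?_ ?_
    · calc (1 : ℝ) = (Real.log (Real.log κ₀⁻¹))⁻¹ * Real.log (Real.log κ₀⁻¹) :=
            (inv_mul_cancel₀ hLL₀.ne').symm
        _ ≤ _ := by gcongr; exact le_max_right _ _
    · exact le_mul_of_one_le_left (by linarith) (le_max_left _ _)
  have hL0 : 0 < Real.log κ⁻¹ := by linarith
  rw [mul_assoc]
  gcongr
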